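/- For $d\geq 1$ let $$\mathcal{O}_d=\mathbb{Q}\Big[x_1,\ldots,x_d,\tfrac1{x_1},\ldots,\tfrac1{x_d},\Big(\tfrac1{x_i-x_j}\Big)_{1\leq i<j\leq d}\Big]\subset\mathbb{Q}(x_1,\ldots,x_d),\qquad \mathcal{O}=\prod_{d\geq 1}\mathcal{O}_d .$$ Write $f^{(d)}\in\mathcal{O}_d$ for the depth $d$ component of $f\in\mathcal{O}$ and set $f^{(0)}=0$. **Shuffle equations modulo products.** For a word $w=v_1\cdots v_r$ put $f^{\sharp}(w)=f^{(r)}(v_1,\,v_1+v_2,\ldots,v_1+\cdots+v_r)$, extended linearly to sums of words. The element $f$ satisfies the shuffle equations modulo products if $$f^{\sharp}(x_1\cdots x_p \mathbin{\sqcup\!\!\sqcup} x_{p+1}\cdots x_{p+q})=0\qquad\text{for all } p,q\geq 1,$$ where $\mathbin{\sqcup\!\!\sqcup}$ is the shuffle product of words. **Stuffle equations modulo products.** For a function $F$ on words, put $F(1*w)=F(w*1)=F(w)$, where $1$ is the empty word, and recursively, for letters $a,b$ and words $u,w$, $$F(au*bw)=F_a(u*bw)+F_b(au*w)+\frac{F_a(u*w)-F_b(u*w)}{a-b},\qquad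 F_c(v):=F(cv).$$ The element $f$ satisfies the stuffle equations modulo products if $$f(x_1\cdots x_p * x_{p+1}\cdots x_{p+q})=0\qquad\text{for all } p,q\geq 1,$$ where $f(v_1\cdots v_r)=f^{(r)}(v_1,\ldots,v_r)$ for a word $v_1\cdots v_r$. Let $\mathfrak{pdmr}\subset\mathcal{O}$ be the set of $f\in\mathcal{O}$ that satisfy both the shuffle and the stuffle equations modulo products. **The elements $\psi_{2n+1}$.** Set $x_0=0$, and for $A,B\subset\{0,\ldots,d\}$ let $x_{A,B}=\prod_{a\in A,\,b\in B}(x_a-x_b)$, which is $1$ if $A$ or $B$ is empty. For $n,d\geq 1$ let $$\begin{aligned}\psi^{(d)}_{2n+1}={}&\frac12\sum_{i=1}^d\Big(\frac{(x_i-x_{i-1})^{2n}}{x_{\{0,\ldots,i-2\},\{i-1\}}\;x_{\{i+1,\ldots,d\},\{i\}}}+\frac{x_d^{2n}}{x_{\{1,\ldots,i-1\},\{0\}}\;x_{\{i,\ldots,d-1\},\{d\}}}\Big)\\&-\frac12\sum_{i=1}^{d-1}\Big(\frac{(x_1-x_d)^{2n}}{x_{\{2,\ldots,i\},\{1\}}\;x_{\{i+1,\ldots,d-1,0\},\{d\}}}+\frac{x_{d-1}^{2n}}{x_{\{d,1,\ldots,i-1\},\{0\}}\;x_{\{i,\ldots,d-2\},\{d-1\}}}\Big),\end{aligned}$$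 and let $\psi_{2n+1}$ be the sequence with depth $d$ component $\psi^{(d)}_{2n+1}$. **Theorem.** For every $n\geq 1$, $\psi_{2n+1}\in\mathfrak{pdmr}$. That is, $\psi^{(d)}_{2n+1}\in\mathcal{O}_d$ for all $d\geq1$, and $\psi_{2n+1}$ satisfies the shuffle and the stuffle equations modulo products. -/

import Mathlib

namespace PolarDoubleShuffle

/-- The field `ℚ(x₁, …, x_d)` of rational functions in `d` variables. -/
abbrev RatFun (d : ℕ) : Type := FractionRing (MvPolynomial (Fin d) ℚ)

/-- The variables of `ℚ(x₁, …, x_d)`, indexed from `0`: `var i` is `x_{i+1}`. -/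
noncomputable def var {d : ℕ} (i : Fin d) : RatFun d :=
  algebraMap (MvPolynomial (Fin d) ℚ) (RatFun d) (MvPolynomial.X i)

/-- The ring `𝒪_d = ℚ[x_i, 1/x_i, 1/(x_i - x_j) (i < j)]`, as a subalgebra of `ℚ(x₁, …, x_d)`. -/
noncomputable def polarRing (d : ℕ) : Subalgebra ℚ (RatFun d) :=
  Algebra.adjoin ℚ
    (Set.range (fun i : Fin d => var i) ∪ Set.range (fun i : Fin d => (var i)⁻¹) ∪
      {z | ∃ i j : Fin d, i < j ∧ z = (var i - var j)⁻¹})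

/-- A sequence `(f^(d))_{d ≥ 0}` of rational functions, `f^(d)` in `d` variables. -/
abbrev RatSeq : Type := ∀ d : ℕ, RatFun d

/-- The space `𝒪 = ∏_{d ≥ 1} 𝒪_d`, as the sequences with `f^(0) = 0` and `f^(d) ∈ 𝒪_d`. -/
def polarSeq : Set RatSeq :=
  {f | f 0 = 0 ∧ ∀ d : ℕ, 1 ≤ d → f d ∈ polarRing d}

/-- The value `f(v₁, …, v_d)` of a rational function `f` at a point with coordinates in a field
`K`: numerator over denominator, for `f` written in lowest terms. In every use below the point
consists of nonzero pairwise distinct elements, where the denominators allowed in `𝒪_d` do not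
vanish. -/
noncomputable def evalAt {K : Type*} [Field K] [Algebra ℚ K] {d : ℕ}
    (f : RatFun d) (v : Fin d → K) : K :=
  MvPolynomial.aeval v (IsFractionRing.num (MvPolynomial (Fin d) ℚ) f) /
    MvPolynomial.aeval v
      (IsFractionRing.den (MvPolynomial (Fin d) ℚ) f : MvPolynomial (Fin d) ℚ)

/-- The value `f^(r)(v₁, …, v_r)` of a sequence at a word `v₁ ⋯ v_r` of length `r`. -/
noncomputable def evalWord {K : Type*} [Field K] [Algebra ℚ K] (f : RatSeq) (v : List K) : K :=
  evalAt (f v.length) v.get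

/-- The terms, with multiplicity, of the shuffle product of two words:
`a u ⧢ b w = a (u ⧢ b w) + b (a u ⧢ w)`. -/
def shuffles {α : Type*} : List α → List α → List (List α)
  | [], w => [w]
  | a :: u, [] => [a :: u]
  | a :: u, b :: w =>
      (shuffles u (b :: w)).map (fun v => a :: v) ++ (shuffles (a :: u) w).map (fun v => b :: v)
termination_by u w => u.length + w.length

/-- The partial sums starting from `s`: `v₁ v₂ ⋯ ↦ (s + v₁, s + v₁ + v₂, …)`. -/
def partialSumsFrom {K : Type*} [Add K] : K → List K → List K
  | _, [] => []
  | s, a :: v => (s + a) :: partialSumsFrom (s + a) v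

/-- `f^♯(v₁ ⋯ v_r) = f(v₁, v₁ + v₂, …, v₁ + ⋯ + v_r)`. -/
noncomputable def sharp {K : Type*} [Field K] [Algebra ℚ K] (f : RatSeq) (v : List K) : K :=
  evalWord f (partialSumsFrom 0 v)

/-- `f^♯(u ⧢ w)`, where `f^♯` is extended linearly to sums of words. -/
noncomputable def shuffleValue {K : Type*} [Field K] [Algebra ℚ K] (f : RatSeq)
    (u w : List K) : K :=
  ((shuffles u w).map (sharp f)).sum

/-- `F(u * w)` for the stuffle product of two words and a function `F` on words:
`F(a u * b w) = F(a (u * b w)) + F(b (a u * w)) + (F(a (u * w)) - F(b (u * w))) / (a - b)`. -/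
noncomputable def stuffle {K : Type*} [Field K] (F : List K → K) : List K → List K → K
  | [], w => F w
  | a :: u, [] => F (a :: u)
  | a :: u, b :: w =>
      stuffle (fun v => F (a :: v)) u (b :: w) + stuffle (fun v => F (b :: v)) (a :: u) w +
        (stuffle (fun v => F (a :: v)) u w - stuffle (fun v => F (b :: v)) u w) / (a - b)
termination_by u w => u.length + w.length

/-- The word `x₁ ⋯ x_p` in `ℚ(x₁, …, x_{p+q})`. -/
noncomputable def leftWord (p q : ℕ) : List (RatFun (p + q)) :=
  List.ofFn fun i : Fin p => var (Fin.castAdd q i)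

/-- The word `x_{p+1} ⋯ x_{p+q}` in `ℚ(x₁, …, x_{p+q})`. -/
noncomputable def rightWord (p q : ℕ) : List (RatFun (p + q)) :=
  List.ofFn fun j : Fin q => var (Fin.natAdd p j)

/-- The shuffle equations modulo products. -/
def ShuffleModProducts (f : RatSeq) : Prop :=
  ∀ p q : ℕ, 1 ≤ p → 1 ≤ q → shuffleValue f (leftWord p q) (rightWord p q) = 0

/-- The stuffle equations modulo products. -/
def StuffleModProducts (f : RatSeq) : Prop :=
  ∀ p q : ℕ, 1 ≤ p → 1 ≤ q → stuffle (evalWord f) (leftWord p q) (rightWord p q) = 0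

/-- The set of solutions in `𝒪` to the double shuffle equations modulo products. -/
def pdmr : Set RatSeq :=
  {f | f ∈ polarSeq ∧ ShuffleModProducts f ∧ StuffleModProducts f}

/-- `x_k ∈ ℚ(x₁, …, x_d)` for `0 ≤ k ≤ d`, with the convention `x₀ = 0`. -/
noncomputable def coord (d k : ℕ) : RatFun d :=
  if h : 1 ≤ k ∧ k ≤ d then var (⟨k - 1, by omega⟩ : Fin d) else 0

/-- `x_{A,B} = ∏_{a ∈ A, b ∈ B} (x_a - x_b)`. -/
noncomputable def xprod (d : ℕ) (A B : Finset ℕ) : RatFun d :=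
  ∏ a ∈ A, ∏ b ∈ B, (coord d a - coord d b)

/-- The element `ψ_{2n+1}`, given by its depth `d` components; for `d = 0` all the sums are empty
and the component is `0`. -/
noncomputable def psi (n : ℕ) : RatSeq := fun d =>
  (1 / 2) * ∑ i ∈ Finset.Icc 1 d,
      ((coord d i - coord d (i - 1)) ^ (2 * n) /
          (xprod d (Finset.range (i - 1)) {i - 1} * xprod d (Finset.Icc (i + 1) d) {i}) +
        coord d d ^ (2 * n) /
          (xprod d (Finset.Icc 1 (i - 1)) {0} * xprod d (Finset.Icc i (d - 1)) {d})) -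
  (1 / 2) * ∑ i ∈ Finset.Icc 1 (d - 1),
      ((coord d 1 - coord d d) ^ (2 * n) /
          (xprod d (Finset.Icc 2 i) {1} * xprod d (insert 0 (Finset.Icc (i + 1) (d - 1))) {d}) +
        coord d (d - 1) ^ (2 * n) /
          (xprod d (insert d (Finset.Icc 1 (i - 1))) {0} *
            xprod d (Finset.Icc i (d - 2)) {d - 1}))

end PolarDoubleShuffle

/-! Functions on words form an algebra under the deconcatenation product `conv`. The shuffle product
(κ = 0) and the stuffle product (κ(a, b) = 1/(a - b)) are both cases of `quasiShuffle κ`, and by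
`quasiShuffle_conv` pairing with such a product turns `conv` into the corresponding product on pairs
of words. This gives the usual bialgebra formalism: primitive functions vanish on products of
nonempty words, and they are closed under linear combinations, commutators
(`IsPrimitive.commutator`) and conjugation by group-like functions (`IsPrimitive.conj`). It
therefore suffices to express ψ through elementary primitive functions, once for each product.

Stuffle: with L_a = `lastFactor g a`, F_a = `firstFactor g a` and the group-like P = `polarProd g
0`, 2ψ = Σ_a a^{2n} F_a - Σ_{a,b} (b - a)^{2n} a⁻¹ [L_a, F_b] + Σ_a a^{2n} P L_a P⁻¹. The four
families of fractions in ψ come from L_a F_b together with F_a, from F_b L_a, and from the two terms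
of P⁻¹, which lives on words of length at most one (`stufflePsi_eq_polarSum`).

Shuffle: let s be the sum of the letters, δ the indicator of one-letter words, λ the function a ↦
a^{2n} on one-letter words, P = `prefixProd g` with inverse S = `suffixProd g`, and A = s^{2n} · (P
δ S). Then 2ψ^♯ = S λ P + A - s⁻¹ [A, δ]. Multiplying by a function of s preserves primitivity,
because s is the same on all terms of a shuffle (`IsPrimitive.mul_letterSum`,
`shufflePsi_eq_polarSum`).

Letters are kept in an abstract alphabet and read in the field through `g`. Words without repeated
letters are the ones for which 1/(a - b) makes sense, hence the `Nodup` conditions. `EvalsTo`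
connects evaluation in lowest terms with the displayed formula. -/

namespace PolarDoubleShuffle

/-! ### Deconcatenation, quasi-shuffle products, primitive and group-like functions. -/

section QuasiShuffle

variable {α K : Type*} [Field K]

/-- The deconcatenation product of two functions on words. -/
def conv (F G : List α → K) (w : List α) : K :=
  ∑ i ∈ Finset.range (w.length + 1), F (w.take i) * G (w.drop i)

/-- The deconcatenation product of two functions on pairs of words. -/
def conv₂ (F G : List α → List α → K) (u w : List α) : K :=
  ∑ i ∈ Finset.range (u.length + 1), ∑ j ∈ Finset.range (w.length + 1),
    F (u.take i) (w.take j) * G (u.drop i) (w.drop j)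

/-- The indicator function of the empty word, the unit of `conv`. -/
def counit : List α → K
  | [] => 1
  | _ :: _ => 0

@[simp] lemma counit_nil : counit ([] : List α) = (1 : K) := rfl

@[simp] lemma counit_cons (a : α) (w : List α) : counit (a :: w) = (0 : K) := rfl

@[simp] lemma counit_append_singleton (w : List α) (a : α) :
    counit (w ++ [a]) = (0 : K) := by cases w <;> rfl

lemma conv_nil (F G : List α → K) : conv F G [] = F [] * G [] := by simp [conv]

lemma conv_cons (F G : List α → K) (a : α) (w : List α) :
    conv F G (a :: w) = F [] * G (a :: w) + conv (fun v => F (a :: v)) G w := by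
  simp only [conv, List.length_cons, Finset.sum_range_succ' _ (w.length + 1)]
  simp [add_comm]

lemma add_conv (F F' G : List α → K) (w : List α) :
    conv (fun v => F v + F' v) G w = conv F G w + conv F' G w := by
  simp [conv, add_mul, Finset.sum_add_distrib]

lemma mul_conv (c : K) (F G : List α → K) (w : List α) :
    conv (fun v => c * F v) G w = c * conv F G w := by
  simp [conv, mul_assoc, Finset.mul_sum]

@[simp] lemma conv_counit (F : List α → K) : conv F counit = F := by
  funext w
  induction w generalizing F with
  | nil => simp [conv_nil]
  | cons a w ih => simp [conv_cons, ih]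

@[simp] lemma counit_conv (F : List α → K) : conv counit F = F := by
  funext w
  cases w with
  | nil => simp [conv_nil]
  | cons a w =>
    have h : (fun v => counit (a :: v) : List α → K) = 0 := rfl
    rw [conv_cons, h]
    simp [conv]

lemma conv_assoc (F G H : List α → K) : conv (conv F G) H = conv F (conv G H) := by
  funext w
  induction w generalizing F G with
  | nil => simp [conv_nil, mul_assoc]
  | cons a w ih =>
    simp only [conv_cons F (conv G H), conv_cons (conv F G), conv_nil, conv_cons G H, ← ih]
    simp only [conv_cons F G, add_conv, mul_conv]
    ring

/-- Triangularity: the cut at the end of `w` contributes `F w * G [] = F w`, and all other cuts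
involve `F` on shorter words only. -/
lemma conv_right_cancel {F F' G : List α → K} (hG : G [] = 1) (h : conv F G = conv F' G) :
    F = F' := by
  funext w
  induction hn : w.length using Nat.strong_induction_on generalizing w with
  | _ n ih =>
    have h1 := congrFun h w
    simp only [conv, Finset.sum_range_succ] at h1
    rw [Finset.sum_congr rfl (g := fun i => F' (w.take i) * G (w.drop i))] at h1
    · simpa [hG] using h1
    · intro i hi
      have := Finset.mem_range.1 hi
      rw [ih i (by omega) (w.take i) (by simp; omega)]

lemma conv₂_mul_mul (A B C D : List α → K) (u w : List α) :
    conv₂ (fun u w => A u * B w) (fun u w => C u * D w) u w = conv A C u * conv B D w := by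
  simp only [conv₂, conv, Finset.sum_mul_sum]
  refine Finset.sum_congr rfl fun i _ => Finset.sum_congr rfl fun j _ => ?_
  ring

lemma add_conv₂ (F F' G : List α → List α → K) (u w : List α) :
    conv₂ (fun u w => F u w + F' u w) G u w = conv₂ F G u w + conv₂ F' G u w := by
  simp [conv₂, add_mul, Finset.sum_add_distrib]

lemma conv₂_add (F G G' : List α → List α → K) (u w : List α) :
    conv₂ F (fun u w => G u w + G' u w) u w = conv₂ F G u w + conv₂ F G' u w := by
  simp [conv₂, mul_add, Finset.sum_add_distrib]

lemma nodup_take_append_take {u w : List α} (h : (u ++ w).Nodup) (i j : ℕ) :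
    (u.take i ++ w.take j).Nodup :=
  h.sublist ((List.take_sublist i u).append (List.take_sublist j w))

lemma nodup_drop_append_drop {u w : List α} (h : (u ++ w).Nodup) (i j : ℕ) :
    (u.drop i ++ w.drop j).Nodup :=
  h.sublist ((List.drop_sublist i u).append (List.drop_sublist j w))

lemma conv₂_congr {F F' G G' : List α → List α → K}
    (hF : ∀ u w, (u ++ w).Nodup → F u w = F' u w) (hG : ∀ u w, (u ++ w).Nodup → G u w = G' u w)
    {u w : List α} (h : (u ++ w).Nodup) : conv₂ F G u w = conv₂ F' G' u w :=
  Finset.sum_congr rfl fun i _ => Finset.sum_congr rfl fun j _ => by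
    rw [hF _ _ (nodup_take_append_take h i j), hG _ _ (nodup_drop_append_drop h i j)]

/-- The same triangularity for pairs of words; prefixes of a pair without repetitions again have
none, so the induction stays inside such pairs. -/
lemma conv₂_right_cancel {F F' G : List α → List α → K} (hG : G [] [] = 1)
    (h : ∀ u w, (u ++ w).Nodup → conv₂ F G u w = conv₂ F' G u w) (u w : List α)
    (huw : (u ++ w).Nodup) : F u w = F' u w := by
  induction hn : u.length + w.length using Nat.strong_induction_on generalizing u w with
  | _ n ih =>
    have h1 := h u w huw
    rw [← sub_eq_zero, conv₂, conv₂, ← Finset.sum_product', ← Finset.sum_product',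
      ← Finset.sum_sub_distrib, Finset.sum_eq_single (u.length, w.length)] at h1
    · simpa [hG, sub_eq_zero] using h1
    · rintro ⟨i, j⟩ hij hne
      simp only [Finset.mem_product, Finset.mem_range] at hij
      have hlt : i + j < n := by
        rcases lt_or_eq_of_le (Nat.lt_succ_iff.1 hij.1) with h2 | h2
        · omega
        · rcases lt_or_eq_of_le (Nat.lt_succ_iff.1 hij.2) with h3 | h3
          · omega
          · exact absurd (by simp [h2, h3]) hne
      rw [ih (i + j) hlt _ _ (nodup_take_append_take huw i j) (by simp; omega), sub_self]
    · intro hnot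
      simp at hnot

/-- The linear functional `F ↦ F(u * w)` for the quasi-shuffle product
`a u * b w = a (u * b w) + b (a u * w) + κ(a, b) (a (u * w) - b (u * w))`. -/
noncomputable def quasiShuffle (κ : α → α → K) : List α → List α → (List α → K) →ₗ[K] K
  | [], w => LinearMap.proj w
  | a :: u, [] => LinearMap.proj (a :: u)
  | a :: u, b :: w =>
      quasiShuffle κ u (b :: w) ∘ₗ LinearMap.funLeft K K (List.cons a) +
        quasiShuffle κ (a :: u) w ∘ₗ LinearMap.funLeft K K (List.cons b) +
        κ a b • quasiShuffle κ u w ∘ₗ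
          (LinearMap.funLeft K K (List.cons a) - LinearMap.funLeft K K (List.cons b))
termination_by u w => u.length + w.length

variable (κ : α → α → K)

@[simp] lemma quasiShuffle_nil_left (w : List α) (F : List α → K) :
    quasiShuffle κ [] w F = F w := by simp [quasiShuffle]

@[simp] lemma quasiShuffle_nil_right (u : List α) (F : List α → K) :
    quasiShuffle κ u [] F = F u := by cases u <;> simp [quasiShuffle]

lemma quasiShuffle_cons_cons (a b : α) (u w : List α) (F : List α → K) :
    quasiShuffle κ (a :: u) (b :: w) F =
      quasiShuffle κ u (b :: w) (fun v => F (a :: v)) +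
        quasiShuffle κ (a :: u) w (fun v => F (b :: v)) +
        κ a b * (quasiShuffle κ u w (fun v => F (a :: v)) -
          quasiShuffle κ u w (fun v => F (b :: v))) := by
  rw [quasiShuffle]
  simp only [LinearMap.add_apply, LinearMap.comp_apply, LinearMap.smul_apply, LinearMap.sub_apply,
    map_sub, smul_eq_mul]
  rfl

lemma conv_cons_eq (F G : List α → K) (a : α) :
    (fun v => conv F G (a :: v)) = F [] • (fun v => G (a :: v)) + conv (fun v => F (a :: v)) G := by
  funext w
  simp [conv_cons]

/-- The quasi-shuffle product is compatible with deconcatenation. -/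
lemma quasiShuffle_conv (F G : List α → K) (u w : List α) :
    quasiShuffle κ u w (conv F G) =
      conv₂ (fun u w => quasiShuffle κ u w F) (fun u w => quasiShuffle κ u w G) u w := by
  induction u generalizing F w with
  | nil => simp [conv₂, conv]
  | cons a u ihu =>
    induction w generalizing F with
    | nil => simp [conv₂, conv]
    | cons b w ihw =>
      rw [quasiShuffle_cons_cons, conv_cons_eq, conv_cons_eq]
      simp only [map_add, map_smul, ihu, ihw, smul_eq_mul]
      -- Each double sum is split according to whether the cut lies before or after the first
      -- letter, so that the recursion of `quasiShuffle` applies to every piece.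
      simp only [conv₂, List.length_cons, Finset.sum_range_succ' _ (u.length + 1),
        Finset.sum_range_succ' _ (w.length + 1), List.take_succ_cons, List.drop_succ_cons,
        List.take_zero, List.drop_zero, quasiShuffle_cons_cons, quasiShuffle_nil_left,
        quasiShuffle_nil_right, add_mul, mul_add, sub_mul, mul_sub, Finset.sum_add_distrib,
        Finset.sum_sub_distrib, Finset.mul_sum, mul_assoc]
      ring

/-- Only words whose letters form a sub-multiset of those of `u ++ w` occur in the product. Hence a
formula for `F` valid on words with distinct letters can be substituted. -/
lemma quasiShuffle_congr {F G : List α → K} {u w : List α}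
    (h : ∀ v, v.Subperm (u ++ w) → F v = G v) : quasiShuffle κ u w F = quasiShuffle κ u w G := by
  induction u generalizing F G w with
  | nil => simpa using h w (List.Subperm.refl w)
  | cons a u ihu =>
    induction w generalizing F G with
    | nil => simpa using h (a :: u) (by rw [List.append_nil])
    | cons b w ihw =>
      have hb : (b :: (a :: u ++ w)).Subperm (a :: u ++ b :: w) :=
        (List.perm_middle (l₁ := a :: u)).symm.subperm
      rw [quasiShuffle_cons_cons, quasiShuffle_cons_cons,
        ihu (w := b :: w) (F := fun v => F (a :: v)) (G := fun v => G (a :: v))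
          fun v hv => h _ ((List.subperm_cons a).2 hv),
        ihw (F := fun v => F (b :: v)) (G := fun v => G (b :: v))
          fun v hv => h _ (((List.subperm_cons b).2 hv).trans hb),
        ihu (w := w) (F := fun v => F (a :: v)) (G := fun v => G (a :: v))
          fun v hv => h _ ((List.subperm_cons a).2 (hv.trans
            ((List.sublist_cons_self b w).append_left u).subperm)),
        ihu (w := w) (F := fun v => F (b :: v)) (G := fun v => G (b :: v))
          fun v hv => h _ (((List.subperm_cons b).2 (hv.trans
            (List.sublist_cons_self a (u ++ w)).subperm)).trans hb)]

/-- `F` is multiplicative for the quasi-shuffle product. -/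
def IsGroupLike (F : List α → K) : Prop :=
  ∀ u w, (u ++ w).Nodup → quasiShuffle κ u w F = F u * F w

/-- `F` is a derivation for the quasi-shuffle product; in particular, it vanishes on products of
nonempty words. -/
def IsPrimitive (F : List α → K) : Prop :=
  ∀ u w, (u ++ w).Nodup → quasiShuffle κ u w F = F u * counit w + counit u * F w

variable {κ}

lemma IsPrimitive.eq_zero {F : List α → K} (hF : IsPrimitive κ F) {u w : List α}
    (h : (u ++ w).Nodup) (hu : u ≠ []) (hw : w ≠ []) : quasiShuffle κ u w F = 0 := by
  rw [hF u w h]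
  cases u <;> cases w <;> simp_all

lemma IsPrimitive.add {F G : List α → K} (hF : IsPrimitive κ F) (hG : IsPrimitive κ G) :
    IsPrimitive κ (F + G) := fun u w h => by
  rw [map_add, hF u w h, hG u w h]
  simp only [Pi.add_apply]
  ring

lemma IsPrimitive.smul (c : K) {F : List α → K} (hF : IsPrimitive κ F) :
    IsPrimitive κ (c • F) := fun u w h => by
  rw [map_smul, hF u w h]
  simp only [Pi.smul_apply, smul_eq_mul]
  ring

lemma IsPrimitive.sum {ι : Type*} (s : Finset ι) {F : ι → List α → K}
    (hF : ∀ i ∈ s, IsPrimitive κ (F i)) : IsPrimitive κ (∑ i ∈ s, F i) := fun u w h => by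
  rw [map_sum, Finset.sum_congr rfl fun i hi => hF i hi u w h]
  simp only [Finset.sum_apply, Finset.sum_add_distrib, Finset.sum_mul, Finset.mul_sum]

/-- In (F⊗1 + 1⊗F)(G⊗1 + 1⊗G) the cross terms F⊗G + G⊗F are symmetric in F and G, so they cancel in
the commutator. -/
lemma IsPrimitive.commutator {F G : List α → K} (hF : IsPrimitive κ F) (hG : IsPrimitive κ G) :
    IsPrimitive κ (conv F G - conv G F) := fun u w h => by
  rw [map_sub, quasiShuffle_conv, quasiShuffle_conv, conv₂_congr hF hG h, conv₂_congr hG hF h]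
  simp only [add_conv₂, conv₂_add, conv₂_mul_mul, conv_counit, counit_conv, Pi.sub_apply]
  ring

/-- (P⊗P)(A⊗1 + 1⊗A)(Q⊗Q) = PAQ⊗PQ + PQ⊗PAQ, and PQ is the unit. -/
lemma IsPrimitive.conj {P A Q : List α → K} (hA : IsPrimitive κ A) (hP : IsGroupLike κ P)
    (hQ : IsGroupLike κ Q) (hPQ : conv P Q = counit) :
    IsPrimitive κ (conv P (conv A Q)) := fun u w h => by
  have h1 : ∀ u w, (u ++ w).Nodup → quasiShuffle κ u w (conv A Q) =
      conv A Q u * Q w + Q u * conv A Q w := fun u w h => by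
    rw [quasiShuffle_conv, conv₂_congr hA hQ h]
    simp only [add_conv₂, conv₂_mul_mul, counit_conv]
  rw [quasiShuffle_conv, conv₂_congr hP h1 h]
  simp only [conv₂_add, conv₂_mul_mul, hPQ]

lemma quasiShuffle_counit {u w : List α} (h : (u ++ w).Nodup) :
    quasiShuffle κ u w counit = counit u * counit w := by
  cases u with
  | nil => simp
  | cons a u =>
    cases w with
    | nil => simp
    | cons b w =>
      rw [quasiShuffle_cons_cons]
      have : ∀ c : α, (fun v => counit (c :: v) : List α → K) = 0 := fun c => rfl
      simp only [this, map_zero]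
      simp

/-- Both the pairing of P with products and P⊗P are left inverses of Q⊗Q, and Q⊗Q can be cancelled.
-/
lemma IsGroupLike.of_conv_eq_counit {P Q : List α → K} (hQ : IsGroupLike κ Q) (hQ1 : Q [] = 1)
    (hPQ : conv P Q = counit) : IsGroupLike κ P := by
  refine conv₂_right_cancel (G := fun u w => quasiShuffle κ u w Q) (by simpa using hQ1) ?_
  intro u w h
  rw [← quasiShuffle_conv, hPQ, conv₂_congr (fun _ _ _ => rfl) hQ h, conv₂_mul_mul, hPQ,
    quasiShuffle_counit h]

lemma conv_eq_counit_comm {P Q : List α → K} (hQ1 : Q [] = 1) (hPQ : conv P Q = counit) :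
    conv Q P = counit :=
  conv_right_cancel hQ1 (by rw [conv_assoc, hPQ, conv_counit, counit_conv])

end QuasiShuffle

/-! ### Membership of ψ in the polar ring, and evaluation of rational functions. -/

section Evaluation

/-- The depth `d` component of `ψ_{2n+1}` at a point `x : ℕ → K`, with `x k` in place of `x_k`. -/
def polarSum {K : Type*} [Field K] (n d : ℕ) (x : ℕ → K) : K :=
  (1 / 2) * ∑ i ∈ Finset.Icc 1 d,
      ((x i - x (i - 1)) ^ (2 * n) /
          ((∏ a ∈ Finset.range (i - 1), ∏ b ∈ {i - 1}, (x a - x b)) *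
            ∏ a ∈ Finset.Icc (i + 1) d, ∏ b ∈ {i}, (x a - x b)) +
        x d ^ (2 * n) /
          ((∏ a ∈ Finset.Icc 1 (i - 1), ∏ b ∈ {0}, (x a - x b)) *
            ∏ a ∈ Finset.Icc i (d - 1), ∏ b ∈ {d}, (x a - x b))) -
  (1 / 2) * ∑ i ∈ Finset.Icc 1 (d - 1),
      ((x 1 - x d) ^ (2 * n) /
          ((∏ a ∈ Finset.Icc 2 i, ∏ b ∈ {1}, (x a - x b)) *
            ∏ a ∈ insert 0 (Finset.Icc (i + 1) (d - 1)), ∏ b ∈ {d}, (x a - x b)) +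
        x (d - 1) ^ (2 * n) /
          ((∏ a ∈ insert d (Finset.Icc 1 (i - 1)), ∏ b ∈ {0}, (x a - x b)) *
            ∏ a ∈ Finset.Icc i (d - 2), ∏ b ∈ {d - 1}, (x a - x b)))

lemma coord_eq {d k : ℕ} (h : 1 ≤ k ∧ k ≤ d) :
    coord d k = var (⟨k - 1, by omega⟩ : Fin d) := dif_pos h

lemma coord_eq_zero {d k : ℕ} (h : ¬(1 ≤ k ∧ k ≤ d)) : coord d k = 0 := dif_neg h

lemma var_mem_polarRing {d : ℕ} (i : Fin d) : var i ∈ polarRing d :=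
  Algebra.subset_adjoin (Or.inl (Or.inl ⟨i, rfl⟩))

lemma coord_mem_polarRing (d k : ℕ) : coord d k ∈ polarRing d := by
  by_cases h : 1 ≤ k ∧ k ≤ d
  · rw [coord_eq h]
    exact var_mem_polarRing _
  · rw [coord_eq_zero h]
    exact zero_mem _

lemma inv_var_mem_polarRing {d : ℕ} (i : Fin d) : (var i)⁻¹ ∈ polarRing d :=
  Algebra.subset_adjoin (Or.inl (Or.inr ⟨i, rfl⟩))

lemma inv_var_sub_var_mem_polarRing {d : ℕ} (i j : Fin d) :
    (var i - var j)⁻¹ ∈ polarRing d := by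
  rcases lt_trichotomy i j with h | rfl | h
  · exact Algebra.subset_adjoin (Or.inr ⟨i, j, h, rfl⟩)
  · simp
  · rw [← neg_sub, inv_neg]
    exact neg_mem (Algebra.subset_adjoin (Or.inr ⟨j, i, h, rfl⟩))

/-- No condition on the indices is needed: when the coordinates coincide, the inverse is `0⁻¹ = 0`.
-/
lemma inv_coord_sub_coord_mem_polarRing (d k l : ℕ) :
    (coord d k - coord d l)⁻¹ ∈ polarRing d := by
  by_cases hk : 1 ≤ k ∧ k ≤ d <;> by_cases hl : 1 ≤ l ∧ l ≤ d
  · rw [coord_eq hk, coord_eq hl]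
    exact inv_var_sub_var_mem_polarRing _ _
  · rw [coord_eq hk, coord_eq_zero hl, sub_zero]
    exact inv_var_mem_polarRing _
  · rw [coord_eq_zero hk, coord_eq hl, zero_sub, inv_neg]
    exact neg_mem (inv_var_mem_polarRing _)
  · simp [coord_eq_zero hk, coord_eq_zero hl]

lemma half_mem_polarRing (d : ℕ) : (1 / 2 : RatFun d) ∈ polarRing d := by
  have h := (polarRing d).algebraMap_mem (1 / 2)
  rwa [map_div₀, map_one, map_ofNat] at h

lemma psi_mem_polarRing (n d : ℕ) : psi n d ∈ polarRing d := by
  have hp : ∀ A B : Finset ℕ, (xprod d A B)⁻¹ ∈ polarRing d := fun A B => by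
    simp only [xprod, ← Finset.prod_inv_distrib]
    exact prod_mem fun a _ => prod_mem fun b _ => inv_coord_sub_coord_mem_polarRing d a b
  have hc := coord_mem_polarRing d
  simp only [psi, div_eq_mul_inv _ (_ * _), mul_inv (xprod _ _ _)]
  refine sub_mem (mul_mem (half_mem_polarRing d) (sum_mem fun i _ => ?_))
    (mul_mem (half_mem_polarRing d) (sum_mem fun i _ => ?_)) <;>
  exact add_mem (mul_mem (pow_mem (sub_mem (hc _) (hc _)) _)
    (mul_mem (hp _ _) (hp _ _))) (mul_mem (pow_mem (hc _) _) (mul_mem (hp _ _) (hp _ _)))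

variable {K : Type*} [Field K] [Algebra ℚ K] {d : ℕ}

/-- The rational function `f` is defined at `v` and takes the value `c` there. -/
def EvalsTo (v : Fin d → K) (f : RatFun d) (c : K) : Prop :=
  ∃ p q : MvPolynomial (Fin d) ℚ, MvPolynomial.aeval v q ≠ 0 ∧
    f * algebraMap _ (RatFun d) q = algebraMap _ (RatFun d) p ∧
    c * MvPolynomial.aeval v q = MvPolynomial.aeval v p

variable {v : Fin d → K}

/-- The reduced denominator divides the denominator of any other representation. If some
representation is defined at `v`, then so is the reduced one, with the same value; this makes
evaluation compatible with field operations. -/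
lemma EvalsTo.evalAt_eq {f : RatFun d} {c : K} (h : EvalsTo v f c) : evalAt f v = c := by
  obtain ⟨p, q, hq, hf, hc⟩ := h
  set num := IsFractionRing.num (MvPolynomial (Fin d) ℚ) f with hnum
  set den := (IsFractionRing.den (MvPolynomial (Fin d) ℚ) f : MvPolynomial (Fin d) ℚ) with hden
  have hden0 : algebraMap _ (RatFun d) den ≠ 0 :=
    IsFractionRing.to_map_ne_zero_of_mem_nonZeroDivisors
      (IsFractionRing.den (MvPolynomial (Fin d) ℚ) f).2
  have hnd : algebraMap _ (RatFun d) num / algebraMap _ (RatFun d) den = f :=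
    IsFractionRing.mk'_num_den' _ f
  have key : num * q = p * den := by
    apply IsFractionRing.injective (MvPolynomial (Fin d) ℚ) (RatFun d)
    rw [map_mul, map_mul, ← hf, ← hnd]
    field_simp
  obtain ⟨r, hr⟩ : den ∣ q :=
    (IsFractionRing.num_den_reduced (MvPolynomial (Fin d) ℚ) f).symm.dvd_of_dvd_mul_left
      (Dvd.intro_left p key.symm)
  have hdv : MvPolynomial.aeval v den ≠ 0 := fun h0 => hq (by rw [hr, map_mul, h0, zero_mul])
  have key' := congrArg (MvPolynomial.aeval v) key
  rw [map_mul, map_mul, ← hc] at key'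
  rw [evalAt, div_eq_iff hdv]
  apply mul_right_cancel₀ hq
  rw [key']
  ring

lemma EvalsTo.algebraMap (p : MvPolynomial (Fin d) ℚ) :
    EvalsTo v (algebraMap _ (RatFun d) p) (MvPolynomial.aeval v p) :=
  ⟨p, 1, by simp, by simp, by simp⟩

lemma EvalsTo.one : EvalsTo v 1 1 := by
  simpa using EvalsTo.algebraMap (v := v) 1

lemma EvalsTo.zero : EvalsTo v 0 0 := by
  simpa using EvalsTo.algebraMap (v := v) 0

variable {f g : RatFun d} {a b : K}

lemma EvalsTo.add (hf : EvalsTo v f a) (hg : EvalsTo v g b) : EvalsTo v (f + g) (a + b) := by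
  obtain ⟨p, q, hq, h, h'⟩ := hf
  obtain ⟨r, s, hs, k, k'⟩ := hg
  refine ⟨p * s + r * q, q * s, by simp [hq, hs], ?_, ?_⟩
  · simp only [map_add, map_mul, ← h, ← k]; ring
  · simp only [map_add, map_mul, ← h', ← k']; ring

lemma EvalsTo.neg (hf : EvalsTo v f a) : EvalsTo v (-f) (-a) := by
  obtain ⟨p, q, hq, h, h'⟩ := hf
  exact ⟨-p, q, hq, by simp [h], by simp [h']⟩

lemma EvalsTo.sub (hf : EvalsTo v f a) (hg : EvalsTo v g b) : EvalsTo v (f - g) (a - b) := by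
  simpa only [sub_eq_add_neg] using hf.add hg.neg

lemma EvalsTo.mul (hf : EvalsTo v f a) (hg : EvalsTo v g b) : EvalsTo v (f * g) (a * b) := by
  obtain ⟨p, q, hq, h, h'⟩ := hf
  obtain ⟨r, s, hs, k, k'⟩ := hg
  refine ⟨p * r, q * s, by simp [hq, hs], ?_, ?_⟩
  · simp only [map_mul, ← h, ← k]; ring
  · simp only [map_mul, ← h', ← k']; ring

lemma EvalsTo.inv (hf : EvalsTo v f a) (ha : a ≠ 0) : EvalsTo v f⁻¹ a⁻¹ := by
  obtain ⟨p, q, hq, h, h'⟩ := hf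
  have hp : MvPolynomial.aeval v p ≠ 0 := h' ▸ mul_ne_zero ha hq
  have hf0 : f ≠ 0 := by
    rintro rfl
    rw [zero_mul, eq_comm, FaithfulSMul.algebraMap_eq_zero_iff] at h
    simp [h] at hp
  refine ⟨q, p, hp, ?_, ?_⟩
  · rw [← h]; field_simp
  · rw [← h']; field_simp

lemma EvalsTo.div (hf : EvalsTo v f a) (hg : EvalsTo v g b) (hb : b ≠ 0) :
    EvalsTo v (f / g) (a / b) := by
  simpa only [div_eq_mul_inv] using hf.mul (hg.inv hb)

lemma EvalsTo.pow (hf : EvalsTo v f a) (m : ℕ) : EvalsTo v (f ^ m) (a ^ m) := by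
  induction m with
  | zero => simpa using EvalsTo.one
  | succ m ih => simpa only [pow_succ] using ih.mul hf

lemma EvalsTo.sum {ι : Type*} (s : Finset ι) {F : ι → RatFun d} {A : ι → K}
    (h : ∀ i ∈ s, EvalsTo v (F i) (A i)) : EvalsTo v (∑ i ∈ s, F i) (∑ i ∈ s, A i) := by
  classical
  induction s using Finset.induction_on with
  | empty => simpa using EvalsTo.zero
  | insert i s hi ih =>
    rw [Finset.sum_insert hi, Finset.sum_insert hi]
    exact (h i (by simp)).add (ih fun j hj => h j (by simp [hj]))

lemma EvalsTo.prod {ι : Type*} (s : Finset ι) {F : ι → RatFun d} {A : ι → K}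
    (h : ∀ i ∈ s, EvalsTo v (F i) (A i)) : EvalsTo v (∏ i ∈ s, F i) (∏ i ∈ s, A i) := by
  classical
  induction s using Finset.induction_on with
  | empty => simpa using EvalsTo.one
  | insert i s hi ih =>
    rw [Finset.prod_insert hi, Finset.prod_insert hi]
    exact (h i (by simp)).mul (ih fun j hj => h j (by simp [hj]))

lemma EvalsTo.half [CharZero K] : EvalsTo v (1 / 2) (1 / 2) := by
  have h := EvalsTo.algebraMap (v := v) 2
  rw [map_ofNat, map_ofNat] at h
  exact EvalsTo.one.div h two_ne_zero

lemma evalsTo_polarSum [CharZero K] (n : ℕ) {x : ℕ → K} (hx : ∀ k ≤ d, EvalsTo v (coord d k) (x k))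
    (hne : ∀ k ≤ d, ∀ l ≤ d, k ≠ l → x k ≠ x l) : EvalsTo v (psi n d) (polarSum n d x) := by
  have hP : ∀ A : Finset ℕ, ∀ b ≤ d, (∀ k ∈ A, k ≤ d) →
      EvalsTo v (xprod d A {b}) (∏ k ∈ A, ∏ l ∈ {b}, (x k - x l)) := fun A b hb hA =>
    EvalsTo.prod _ fun k hk => EvalsTo.prod _ fun l hl =>
      (hx k (hA k hk)).sub (hx l (by rwa [Finset.mem_singleton.1 hl]))
  have hN : ∀ A : Finset ℕ, ∀ b ≤ d, (∀ k ∈ A, k ≤ d ∧ k ≠ b) →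
      ∏ k ∈ A, ∏ l ∈ {b}, (x k - x l) ≠ 0 := fun A b hb hA => by
    refine Finset.prod_ne_zero_iff.2 fun k hk => ?_
    rw [Finset.prod_singleton]
    exact sub_ne_zero.2 (hne k (hA k hk).1 b hb (hA k hk).2)
  have hQ : ∀ A B : Finset ℕ, ∀ a ≤ d, ∀ b ≤ d, (∀ k ∈ A, k ≤ d ∧ k ≠ a) →
      (∀ k ∈ B, k ≤ d ∧ k ≠ b) → ∀ {f : RatFun d} {c : K}, EvalsTo v f c →
      EvalsTo v (f / (xprod d A {a} * xprod d B {b}))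
        (c / ((∏ k ∈ A, ∏ l ∈ {a}, (x k - x l)) * ∏ k ∈ B, ∏ l ∈ {b}, (x k - x l))) :=
    fun A B a ha b hb hA hB f c hf =>
      hf.div ((hP A a ha fun k hk => (hA k hk).1).mul (hP B b hb fun k hk => (hB k hk).1))
        (mul_ne_zero (hN A a ha hA) (hN B b hb hB))
  refine EvalsTo.sub (EvalsTo.half.mul (EvalsTo.sum _ fun i hi => ?_))
    (EvalsTo.half.mul (EvalsTo.sum _ fun i hi => ?_))
  · have hi' := Finset.mem_Icc.1 hi
    refine EvalsTo.add (hQ _ _ _ (by omega) _ (by omega) ?_ ?_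
      (((hx i (by omega)).sub (hx _ (by omega))).pow _))
      (hQ _ _ _ (by omega) _ (by omega) ?_ ?_ ((hx d le_rfl).pow _)) <;>
    · intro k hk
      simp only [Finset.mem_Icc, Finset.mem_range] at hk
      omega
  · have hi' := Finset.mem_Icc.1 hi
    refine EvalsTo.add (hQ _ _ _ (by omega) _ (by omega) ?_ ?_
      (((hx 1 (by omega)).sub (hx _ (by omega))).pow _))
      (hQ _ _ _ (by omega) _ (by omega) ?_ ?_ ((hx (d - 1) (by omega)).pow _)) <;>
    · intro k hk
      simp only [Finset.mem_Icc, Finset.mem_insert] at hk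
      omega

/-- The value of `ψ_{2n+1}` at a word of nonzero pairwise distinct letters. -/
lemma evalWord_psi [CharZero K] (n : ℕ) (v : List K) {x : ℕ → K} (hx0 : x 0 = 0)
    (hx : ∀ k (h : k < v.length), x (k + 1) = v[k])
    (hne : ∀ k ≤ v.length, ∀ l ≤ v.length, k ≠ l → x k ≠ x l) :
    evalWord (psi n) v = polarSum n v.length x := by
  refine (evalsTo_polarSum n (fun k hk => ?_) hne).evalAt_eq
  rcases k with _ | k
  · rw [coord_eq_zero (by omega), hx0]
    exact EvalsTo.zero
  · rw [coord_eq (by omega), hx k (by omega)]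
    simpa [var] using EvalsTo.algebraMap (v := v.get) (MvPolynomial.X ⟨k, by omega⟩)

end Evaluation

/-! ### Segments of a word, and functions supported on single letters. -/

section Segments

/-- The product of the `(x_a - c)⁻¹` for `i ≤ a < j`. -/
def invProd {K : Type*} [Field K] (x : ℕ → K) (c : K) (i j : ℕ) : K :=
  ∏ a ∈ Finset.Ico i j, (x a - c)⁻¹

/-- Common target of the two comparisons: indices are shifted to start at 0, and the factors from
the inserted elements `0` and `d` are pulled out of the sums. -/
lemma polarSum_succ {K : Type*} [Field K] (n e : ℕ) (x : ℕ → K) :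
    polarSum n (e + 1) x =
      (1 / 2) * (∑ k ∈ Finset.range (e + 1), (x (k + 1) - x k) ^ (2 * n) *
            (invProd x (x k) 0 k * invProd x (x (k + 1)) (k + 2) (e + 2)) +
          x (e + 1) ^ (2 * n) * ∑ k ∈ Finset.range (e + 1),
            invProd x (x 0) 1 (k + 1) * invProd x (x (e + 1)) (k + 1) (e + 1)) -
        (1 / 2) * ((x 1 - x (e + 1)) ^ (2 * n) * (x 0 - x (e + 1))⁻¹ * ∑ k ∈ Finset.range e,
            invProd x (x 1) 2 (k + 2) * invProd x (x (e + 1)) (k + 2) (e + 1) +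
          x e ^ (2 * n) * (x (e + 1) - x 0)⁻¹ * ∑ k ∈ Finset.range e,
            invProd x (x 0) 1 (k + 1) * invProd x (x e) (k + 1) e) := by
  have hI : ∀ i j, Finset.Icc i j = Finset.Ico i (j + 1) := fun i j => by ext; simp
  simp only [polarSum, hI, Finset.sum_Ico_eq_sum_range, Finset.prod_singleton]
  refine congrArg₂ _ (congrArg _ ?_) (congrArg _ ?_)
  · rw [Finset.mul_sum, ← Finset.sum_add_distrib]
    refine Finset.sum_congr rfl fun k hk => ?_
    simp only [invProd, Finset.prod_inv_distrib, div_eq_mul_inv, mul_inv, Finset.range_eq_Ico]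
    simp only [show 1 + k = k + 1 by omega, Nat.add_sub_cancel]
  · rw [Finset.mul_sum, Finset.mul_sum, ← Finset.sum_add_distrib]
    refine Finset.sum_congr rfl fun k hk => ?_
    have hk' := Finset.mem_range.1 hk
    rw [Finset.prod_insert (by simp), Finset.prod_insert (by simp; omega)]
    simp only [invProd, Finset.prod_inv_distrib, div_eq_mul_inv, mul_inv]
    simp only [show 1 + k = k + 1 by omega, show e + 1 - 2 + 1 = e by omega,
      Nat.add_sub_cancel]
    ring

variable {α K : Type*} [Field K]

/-- The part of a word from position `i` to position `j`. -/
def segment (v : List α) (i j : ℕ) : List α := (v.take j).drop i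

lemma segment_zero_length (v : List α) : segment v 0 v.length = v := by simp [segment]

lemma segment_self (v : List α) (i : ℕ) : segment v i i = [] := by simp [segment]

lemma segment_succ_right {v : List α} {i j : ℕ} (hij : i ≤ j) (hj : j < v.length) :
    segment v i (j + 1) = segment v i j ++ [v[j]] := by
  rw [segment, List.take_succ_eq_append_getElem hj, List.drop_append_of_le_length (by simp; omega),
    segment]

lemma segment_eq_cons {v : List α} {i j : ℕ} (hij : i < j) (hj : j ≤ v.length) :
    segment v i j = v[i] :: segment v (i + 1) j := by
  rw [segment, List.drop_eq_getElem_cons (by simp; omega), List.getElem_take, segment]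

lemma conv_segment (F G : List α → K) {v : List α} {i j : ℕ} (hij : i ≤ j) (hj : j ≤ v.length) :
    conv F G (segment v i j) =
      ∑ k ∈ Finset.Ico i (j + 1), F (segment v i k) * G (segment v k j) := by
  rw [Finset.sum_Ico_eq_sum_range, conv]
  have hl : (segment v i j).length + 1 = j + 1 - i := by simp [segment]; omega
  rw [hl]
  refine Finset.sum_congr rfl fun k hk => ?_
  have hk' := Finset.mem_range.1 hk
  simp only [segment, List.take_drop, List.take_take, List.drop_drop]
  rw [min_eq_left (by omega)]

/-- The function on words supported on the words of length one. -/
def letterFn (h : α → K) : List α → K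
  | [a] => h a
  | _ => 0

@[simp] lemma letterFn_nil (h : α → K) : letterFn h [] = 0 := rfl

lemma letterFn_cons (h : α → K) (a : α) (w : List α) :
    letterFn h (a :: w) = h a * counit w := by
  cases w <;> simp [letterFn]

lemma letterFn_append_singleton (h : α → K) (w : List α) (a : α) :
    letterFn h (w ++ [a]) = counit w * h a := by
  rcases w with _ | ⟨b, _ | ⟨c, w⟩⟩ <;> simp [letterFn]

lemma conv_append_singleton (F G : List α → K) (w : List α) (a : α) :
    conv F G (w ++ [a]) = conv F (fun v => G (v ++ [a])) w + F (w ++ [a]) * G [] := by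
  rw [conv, conv, List.length_append, List.length_singleton, Finset.sum_range_succ]
  congr 1
  · refine Finset.sum_congr rfl fun i hi => ?_
    have hi' := Nat.lt_succ_iff.1 (Finset.mem_range.1 hi)
    rw [List.take_append_of_le_length hi', List.drop_append_of_le_length hi']
  · rw [List.take_of_length_le (by simp), List.drop_of_length_le (by simp)]

/-- Only the cut just before the last letter contributes; for `h = 1` the right factor deletes that
letter. -/
lemma conv_letterFn_append_singleton (F : List α → K) (h : α → K) (w : List α) (a : α) :
    conv F (letterFn h) (w ++ [a]) = F w * h a := by
  have h1 : (fun v => letterFn h (v ++ [a])) = fun v => h a * counit v := by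
    funext v
    rw [letterFn_append_singleton, mul_comm]
  have h2 : conv F (fun v => h a * counit v) w = h a * conv F counit w := by
    simp only [conv, Finset.mul_sum]
    exact Finset.sum_congr rfl fun i _ => by ring
  rw [conv_append_singleton, h1, h2, conv_counit, letterFn_nil]
  ring

lemma letterFn_conv_cons (F : List α → K) (h : α → K) (w : List α) (a : α) :
    conv (letterFn h) F (a :: w) = h a * F w := by
  rw [conv_cons, funext (letterFn_cons h a), mul_conv, counit_conv, letterFn_nil, zero_mul,
    zero_add]

end Segments

/-! ### Group-like and primitive functions for the stuffle product. -/

section Stuffle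

variable {α K : Type*} [Field K] (g : α → K)

/-- The coefficient of the contracted terms in the stuffle product. -/
def stuffleCoeff (a b : α) : K := (g a - g b)⁻¹

/-- The product of the `(z - c)⁻¹` over the letters `z` of a word. -/
def polarProd (c : K) (w : List α) : K := (w.map fun z => (g z - c)⁻¹).prod

@[simp] lemma polarProd_nil (c : K) : polarProd g c ([] : List α) = 1 := rfl

@[simp] lemma polarProd_cons (c : K) (a : α) (w : List α) :
    polarProd g c (a :: w) = (g a - c)⁻¹ * polarProd g c w := rfl

variable {g}

/-- With A = 1/(a - c) and B = 1/(b - c), partial fractions give (A - B)/(a - b) = -AB. The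
contracted term thus removes one of the two copies of AB coming from the uncontracted terms. -/
lemma quasiShuffle_polarProd (hg : Function.Injective g) {c : K} {u w : List α}
    (h : (u ++ w).Nodup) (hc : ∀ z ∈ u ++ w, g z ≠ c) :
    quasiShuffle (stuffleCoeff g) u w (polarProd g c) = polarProd g c u * polarProd g c w := by
  have hcons : ∀ a : α, (fun v => polarProd g c (a :: v)) = (g a - c)⁻¹ • polarProd g c :=
    fun a => rfl
  induction u generalizing w with
  | nil => simp
  | cons a u ihu =>
    induction w with
    | nil => simp
    | cons b w ihw =>
      have ha : g a - c ≠ 0 := sub_ne_zero.2 (hc a (by simp))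
      have hb : g b - c ≠ 0 := sub_ne_zero.2 (hc b (by simp))
      have hab : g a - g b ≠ 0 := sub_ne_zero.2 fun h' => by
        have := hg h'
        simp [this] at h
      have s1 : (u ++ b :: w).Sublist (a :: u ++ b :: w) := List.sublist_cons_self _ _
      have s2 : (a :: u ++ w).Sublist (a :: u ++ b :: w) :=
        (List.sublist_cons_self b w).append_left _
      have s3 : (u ++ w).Sublist (a :: u ++ b :: w) := (List.sublist_cons_self _ _).trans s2
      rw [quasiShuffle_cons_cons, hcons, hcons]
      simp only [map_smul, smul_eq_mul]
      rw [ihu (h.sublist s1) fun z hz => hc z (s1.subset hz),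
        ihw (h.sublist s2) fun z hz => hc z (s2.subset hz),
        ihu (h.sublist s3) fun z hz => hc z (s3.subset hz), stuffleCoeff]
      simp only [polarProd_cons]
      field_simp
      ring

lemma isGroupLike_polarProd (hg : Function.Injective g) (hg0 : ∀ a, g a ≠ 0) :
    IsGroupLike (stuffleCoeff g) (polarProd g 0) := fun _ _ h =>
  quasiShuffle_polarProd hg h fun z _ => hg0 z

variable (g) in
/-- The inverse of `polarProd g 0` for the deconcatenation product. -/
def polarInv : List α → K
  | [] => 1
  | a :: w => -(g a)⁻¹ * counit w

lemma polarInv_append_singleton (w : List α) (a : α) :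
    polarInv g (w ++ [a]) = -(g a)⁻¹ * counit w := by
  cases w <;> simp [polarInv]

lemma conv_polarInv_append_singleton (F : List α → K) (w : List α) (a : α) :
    conv F (polarInv g) (w ++ [a]) = F (w ++ [a]) - F w * (g a)⁻¹ := by
  have h2 : conv F (fun v => -(g a)⁻¹ * counit v) w = -(g a)⁻¹ * conv F counit w := by
    simp only [conv, Finset.mul_sum]
    exact Finset.sum_congr rfl fun i _ => by ring
  simp only [conv_append_singleton, polarInv_append_singleton, h2, conv_counit]
  simp only [polarInv]
  ring

lemma isGroupLike_polarInv (hg : Function.Injective g) (hg0 : ∀ a, g a ≠ 0) :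
    IsGroupLike (stuffleCoeff g) (polarInv g) := fun u w h => by
  cases u with
  | nil => simp [polarInv]
  | cons a u =>
    cases w with
    | nil => simp [polarInv]
    | cons b w =>
      have ha := hg0 a
      have hb := hg0 b
      have hab : g a - g b ≠ 0 := sub_ne_zero.2 fun h' => by
        have := hg h'
        simp [this] at h
      have h1 : (u ++ b :: w).Nodup := h.sublist (List.sublist_cons_self _ _)
      have h2 : (a :: u ++ w).Nodup := h.sublist ((List.sublist_cons_self b w).append_left _)
      have h3 : (u ++ w).Nodup := h2.sublist (List.sublist_cons_self _ _)
      have hcons : ∀ c : α, (fun v => polarInv g (c :: v)) = (-(g c)⁻¹) • counit := fun c => rfl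
      rw [quasiShuffle_cons_cons, hcons, hcons]
      simp only [map_smul, smul_eq_mul, quasiShuffle_counit h1, quasiShuffle_counit h2,
        quasiShuffle_counit h3, stuffleCoeff, polarInv, counit_cons]
      field_simp
      ring

lemma polarProd_append_singleton (c : K) (w : List α) (a : α) :
    polarProd g c (w ++ [a]) = polarProd g c w * (g a - c)⁻¹ := by
  simp [polarProd]

lemma conv_polarProd_polarInv : conv (polarProd g 0) (polarInv g) = counit := by
  funext w
  rcases List.eq_nil_or_concat w with rfl | ⟨w, a, rfl⟩
  · simp [conv_nil, polarInv]
  · rw [List.concat_eq_append, conv_polarInv_append_singleton, polarProd_append_singleton, sub_zero,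
      sub_self, counit_append_singleton]

variable [DecidableEq α]

variable (g) in
/-- The function `w a ↦ polarProd g (g a) w` on the words that end with the letter `a`. -/
def lastFactor (a : α) : List α → K
  | [] => 0
  | c :: v => (g c - g a)⁻¹ * lastFactor a v + (if c = a then 1 else 0) * counit v

variable (g) in
/-- The function `a w ↦ polarProd g (g a) w` on the words that start with the letter `a`. -/
def firstFactor (a : α) : List α → K
  | [] => 0
  | c :: v => if c = a then polarProd g (g a) v else 0

@[simp] lemma lastFactor_nil (a : α) : lastFactor g a [] = 0 := rfl

@[simp] lemma firstFactor_nil (a : α) : firstFactor g a [] = 0 := rfl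

lemma lastFactor_append_singleton (a c : α) (w : List α) :
    lastFactor g a (w ++ [c]) = if c = a then polarProd g (g a) w else 0 := by
  induction w with
  | nil => simp [lastFactor]
  | cons b w ih =>
    rw [List.cons_append, lastFactor, ih, counit_append_singleton]
    split_ifs <;> simp

lemma lastFactor_eq_zero {a : α} {w : List α} (h : a ∉ w) : lastFactor g a w = 0 := by
  rcases List.eq_nil_or_concat w with rfl | ⟨w, c, rfl⟩
  · rfl
  · rw [List.concat_eq_append, lastFactor_append_singleton, if_neg]
    rintro rfl
    simp at h

/-- Only terms starting with `a` count. If `a` begins one of the two words, the rest is evaluated by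
the multiplicative `polarProd g (g a)`: the first letter of the other word contributes a factor that
the contracted term cancels. -/
lemma isPrimitive_firstFactor (hg : Function.Injective g) (a : α) :
    IsPrimitive (stuffleCoeff g) (firstFactor g a) := fun u w h => by
  cases u with
  | nil => simp
  | cons c u =>
    cases w with
    | nil => simp
    | cons d w =>
      have hcd : c ≠ d := by rintro rfl; simp at h
      have h1 : (u ++ d :: w).Nodup := h.sublist (List.sublist_cons_self _ _)
      have h2 : (c :: u ++ w).Nodup := h.sublist ((List.sublist_cons_self d w).append_left _)
      have h3 : (u ++ w).Nodup := h2.sublist (List.sublist_cons_self _ _)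
      have hc : c ∉ u ++ d :: w := (List.nodup_cons.1 h).1
      have hd : d ∉ c :: u ++ w := (List.nodup_middle.1 h : (d :: (c :: u ++ w)).Nodup).notMem
      have hcons : ∀ b : α, (fun v => firstFactor g a (b :: v)) =
          (if b = a then (1 : K) else 0) • polarProd g (g a) := fun b => by
        funext v
        simp [firstFactor]
      rw [quasiShuffle_cons_cons, hcons, hcons]
      simp only [map_smul, smul_eq_mul, counit_cons, mul_zero, zero_mul, add_zero]
      have hgcd : g c - g d ≠ 0 := sub_ne_zero.2 (hg.ne hcd)
      have hgdc : g d - g c ≠ 0 := sub_ne_zero.2 (hg.ne hcd.symm)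
      by_cases hca : c = a
      · subst hca
        rw [if_pos rfl, if_neg hcd.symm,
          quasiShuffle_polarProd hg h1 fun z hz => hg.ne fun e : z = c => hc (e ▸ hz),
          quasiShuffle_polarProd hg h3 fun z hz => hg.ne fun e : z = c => hc
            (e ▸ ((List.sublist_cons_self d w).append_left u).subset hz), stuffleCoeff,
          polarProd_cons, ← neg_sub (g c) (g d), inv_neg]
        ring
      · rw [if_neg hca]
        by_cases hda : d = a
        · subst hda
          rw [if_pos rfl,
            quasiShuffle_polarProd hg h2 fun z hz => hg.ne fun e : z = d => hd (e ▸ hz),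
            quasiShuffle_polarProd hg h3 fun z hz => hg.ne fun e : z = d => hd
              (e ▸ (List.sublist_cons_self c (u ++ w)).subset hz), stuffleCoeff, polarProd_cons]
          ring
        · rw [if_neg hda]
          ring

/-- Removing a first letter `c` turns `lastFactor g a` into a combination of itself and `counit`,
which matches the recursion of the product. If neither first letter is `a`, the partial fraction
identity makes the terms cancel; if one is, `lastFactor g a` vanishes on both tails and only
`counit` terms remain. -/
lemma isPrimitive_lastFactor (hg : Function.Injective g) (a : α) :
    IsPrimitive (stuffleCoeff g) (lastFactor g a) := fun u w h => by
  have hcons : ∀ c : α, (fun v => lastFactor g a (c :: v)) =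
      (g c - g a)⁻¹ • lastFactor g a + (if c = a then (1 : K) else 0) • counit := fun c => by
    funext v
    by_cases hca : c = a <;> simp [lastFactor, hca]
  induction u generalizing w with
  | nil => simp
  | cons c u ihu =>
    induction w with
    | nil => simp
    | cons d w ihw =>
      have hcd : c ≠ d := by rintro rfl; simp at h
      have h1 : (u ++ d :: w).Nodup := h.sublist (List.sublist_cons_self _ _)
      have h2 : (c :: u ++ w).Nodup := h.sublist ((List.sublist_cons_self d w).append_left _)
      have h3 : (u ++ w).Nodup := h2.sublist (List.sublist_cons_self _ _)
      have hc : c ∉ u ++ d :: w := (List.nodup_cons.1 h).1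
      have hd : d ∉ c :: u ++ w := (List.nodup_middle.1 h : (d :: (c :: u ++ w)).Nodup).notMem
      have hgcd : g c - g d ≠ 0 := sub_ne_zero.2 (hg.ne hcd)
      rw [quasiShuffle_cons_cons, hcons, hcons]
      simp only [map_add, map_smul, smul_eq_mul, ihu _ h1, ihw h2, ihu _ h3,
        quasiShuffle_counit h1, quasiShuffle_counit h2, quasiShuffle_counit h3,
        stuffleCoeff, lastFactor, counit_cons]
      by_cases hca : c = a
      · subst hca
        have hu : lastFactor g c u = 0 := lastFactor_eq_zero fun e => hc (by simp [e])
        have hw : lastFactor g c w = 0 := lastFactor_eq_zero fun e => hc (by simp [e])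
        simp only [if_true, if_neg hcd.symm, hu, hw]
        rw [← neg_sub (g c) (g d), inv_neg]
        ring
      · by_cases hda : d = a
        · subst hda
          have hu : lastFactor g d u = 0 := lastFactor_eq_zero fun e => hd (by simp [e])
          have hw : lastFactor g d w = 0 := lastFactor_eq_zero fun e => hd (by simp [e])
          simp only [if_true, if_neg hca, hu, hw]
          ring
        · have ha : g c - g a ≠ 0 := sub_ne_zero.2 (hg.ne hca)
          have hb : g d - g a ≠ 0 := sub_ne_zero.2 (hg.ne hda)
          simp only [if_neg hca, if_neg hda]
          field_simp
          ring

end Stuffle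

/-! ### ψ as a combination of primitive functions for the stuffle product. -/

section StuffleForm

variable {α K : Type*} [Field K] {g : α → K}

section Values

variable {v : List α} {x : ℕ → K} (hx : ∀ k (h : k < v.length), x (k + 1) = g v[k])
include hx

lemma polarProd_segment (c : K) {i j : ℕ} (hij : i ≤ j) (hj : j ≤ v.length) :
    polarProd g c (segment v i j) = invProd x c (i + 1) (j + 1) := by
  induction j, hij using Nat.le_induction with
  | base => simp [segment_self, invProd]
  | succ j hij ih =>
    rw [segment_succ_right hij (by omega), polarProd_append_singleton, ih (by omega), invProd,
      invProd, Finset.prod_Ico_succ_top (by omega : i + 1 ≤ j + 1), hx j (by omega)]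

variable [DecidableEq α]

lemma lastFactor_segment (a : α) {i j : ℕ} (hij : i ≤ j) (hj : j < v.length) :
    lastFactor g a (segment v i (j + 1)) =
      if v[j] = a then invProd x (x (j + 1)) (i + 1) (j + 1) else 0 := by
  rw [segment_succ_right hij hj, lastFactor_append_singleton]
  split_ifs with h
  · rw [polarProd_segment hx _ hij hj.le, hx j hj, h]
  · rfl

lemma firstFactor_segment (a : α) {i j : ℕ} (hij : i < j) (hj : j ≤ v.length) :
    firstFactor g a (segment v i j) =
      if v[i] = a then invProd x (x (i + 1)) (i + 2) (j + 1) else 0 := by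
  rw [segment_eq_cons hij hj, firstFactor]
  split_ifs with h
  · rw [polarProd_segment hx _ hij hj, hx i (by omega), h]
  · rfl

variable [Fintype α]

lemma sum_firstFactor {e : ℕ} (he : v.length = e + 1) (H : K → K) :
    ∑ a, H (g a) * firstFactor g a v = H (x 1) * invProd x (x 1) 2 (e + 2) := by
  have h1 : ∀ a, firstFactor g a v = if v[0] = a then invProd x (x 1) 2 (e + 2) else 0 :=
    fun a => by
      have h2 := firstFactor_segment hx a (by omega : 0 < e + 1) he.ge
      rwa [show segment v 0 (e + 1) = v by rw [← he, segment_zero_length]] at h2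
  simp only [h1, mul_ite, mul_zero, Finset.sum_ite_eq, Finset.mem_univ, if_true, hx 0 (by omega)]

/-- At each cut the only contributing pair (a, b) consists of the two letters adjacent to the cut.
-/
lemma sum_conv_lastFactor_firstFactor {e : ℕ} (he : v.length = e + 1) (H : K → K → K) :
    ∑ a, ∑ b, H (g a) (g b) * conv (lastFactor g a) (firstFactor g b) v =
      ∑ k ∈ Finset.range e, H (x (k + 1)) (x (k + 2)) *
        (invProd x (x (k + 1)) 1 (k + 1) * invProd x (x (k + 2)) (k + 3) (e + 2)) := by
  have h1 : ∀ a b, conv (lastFactor g a) (firstFactor g b) v = ∑ k ∈ Finset.range e,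
      lastFactor g a (segment v 0 (k + 1)) * firstFactor g b (segment v (k + 1) (e + 1)) := by
    intro a b
    conv_lhs => rw [← segment_zero_length v]
    rw [conv_segment _ _ (Nat.zero_le _) le_rfl, ← Finset.range_eq_Ico, he, Finset.sum_range_succ,
      Finset.sum_range_succ', segment_self, segment_self]
    simp
  simp only [h1, Finset.mul_sum]
  rw [Finset.sum_congr rfl fun a _ => Finset.sum_comm, Finset.sum_comm]
  refine Finset.sum_congr rfl fun k hk => ?_
  have hk' := Finset.mem_range.1 hk
  simp only [lastFactor_segment hx _ (Nat.zero_le k) (by omega : k < v.length),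
    firstFactor_segment hx _ (by omega : k + 1 < e + 1) he.ge, mul_ite, ite_mul, mul_zero, zero_mul,
    Finset.sum_ite_eq, Finset.mem_univ, if_true, hx k (by omega), hx (k + 1) (by omega)]

/-- In this order the contributing letters are the first and the last of the whole word, whatever
the cut, so `H` comes out of the sum. -/
lemma sum_conv_firstFactor_lastFactor {e : ℕ} (he : v.length = e + 1) (H : K → K → K) :
    ∑ a, ∑ b, H (g a) (g b) * conv (firstFactor g b) (lastFactor g a) v =
      H (x (e + 1)) (x 1) * ∑ k ∈ Finset.range e,
        invProd x (x 1) 2 (k + 2) * invProd x (x (e + 1)) (k + 2) (e + 1) := by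
  have h1 : ∀ a b, conv (firstFactor g b) (lastFactor g a) v = ∑ k ∈ Finset.range e,
      firstFactor g b (segment v 0 (k + 1)) * lastFactor g a (segment v (k + 1) (e + 1)) := by
    intro a b
    conv_lhs => rw [← segment_zero_length v]
    rw [conv_segment _ _ (Nat.zero_le _) le_rfl, ← Finset.range_eq_Ico, he, Finset.sum_range_succ,
      Finset.sum_range_succ', segment_self, segment_self]
    simp
  simp only [h1, Finset.mul_sum]
  rw [Finset.sum_congr rfl fun a _ => Finset.sum_comm, Finset.sum_comm]
  refine Finset.sum_congr rfl fun k hk => ?_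
  have hk' := Finset.mem_range.1 hk
  rw [Finset.sum_comm]
  simp only [lastFactor_segment hx _ (by omega : k + 1 ≤ e) (by omega : e < v.length),
    firstFactor_segment hx _ (by omega : 0 < k + 1) (by omega), mul_ite, ite_mul, mul_zero,
    zero_mul, Finset.sum_ite_eq, Finset.mem_univ, if_true, hx e (by omega), hx 0 (by omega)]

lemma sum_conv_polarProd_lastFactor (H : K → K) {j : ℕ} (hj : j ≤ v.length) :
    ∑ a, H (g a) * conv (polarProd g 0) (lastFactor g a) (segment v 0 j) =
      H (x j) * ∑ k ∈ Finset.range j, invProd x 0 1 (k + 1) * invProd x (x j) (k + 1) j := by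
  rcases j with _ | j
  · simp [segment_self, conv_nil]
  simp only [conv_segment _ _ (Nat.zero_le _) hj, ← Finset.range_eq_Ico,
    Finset.sum_range_succ _ (j + 1), segment_self, lastFactor_nil, mul_zero, add_zero,
    Finset.mul_sum]
  rw [Finset.sum_comm]
  refine Finset.sum_congr rfl fun k hk => ?_
  have hk' := Finset.mem_range.1 hk
  simp only [lastFactor_segment hx _ (by omega : k ≤ j) (by omega : j < v.length),
    polarProd_segment hx _ (Nat.zero_le k) (by omega), mul_ite, mul_zero, Finset.sum_ite_eq,
    Finset.mem_univ, if_true, hx j (by omega)]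

end Values

variable [DecidableEq α] [Fintype α]

variable (g) in
/-- The value of `ψ_{2n+1}` at a word, in terms of primitive elements for the stuffle product. -/
noncomputable def stufflePsi (n : ℕ) : List α → K :=
  (1 / 2 : K) • (∑ a, (g a ^ (2 * n)) • firstFactor g a +
    ∑ a, ∑ b, ((g b - g a) ^ (2 * n) * -(g a)⁻¹) •
      (conv (lastFactor g a) (firstFactor g b) - conv (firstFactor g b) (lastFactor g a)) +
    ∑ a, (g a ^ (2 * n)) • conv (polarProd g 0) (conv (lastFactor g a) (polarInv g)))

lemma isPrimitive_stufflePsi (hg : Function.Injective g) (hg0 : ∀ a, g a ≠ 0) (n : ℕ) :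
    IsPrimitive (stuffleCoeff g) (stufflePsi g n) := by
  refine .smul _ (.add (.add (.sum _ fun a _ => .smul _ (isPrimitive_firstFactor hg a))
    (.sum _ fun a _ => .sum _ fun b _ => .smul _ ?_)) (.sum _ fun a _ => .smul _ ?_))
  · exact (isPrimitive_lastFactor hg a).commutator (isPrimitive_firstFactor hg b)
  · exact (isPrimitive_lastFactor hg a).conj (isGroupLike_polarProd hg hg0)
      (isGroupLike_polarInv hg hg0) conv_polarProd_polarInv

lemma stufflePsi_eq_polarSum (n : ℕ) {v : List α} {x : ℕ → K} (hx0 : x 0 = 0)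
    (hx : ∀ k (h : k < v.length), x (k + 1) = g v[k]) :
    stufflePsi g n v = polarSum n v.length x := by
  rcases hv : v.length with _ | e
  · rw [List.length_eq_zero_iff] at hv
    subst hv
    simp [stufflePsi, polarSum, conv_nil]
  have hsplit : v = segment v 0 e ++ [v[e]] := by
    rw [← segment_succ_right (Nat.zero_le e) (by omega), ← hv, segment_zero_length]
  -- `polarInv g` sees at most the last letter; its two terms give the `x_d ^ (2n)` and the `x_{d-1}
  -- ^ (2n)` fractions of ψ.
  have hD : ∀ a, conv (polarProd g 0) (conv (lastFactor g a) (polarInv g)) v =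
      conv (polarProd g 0) (lastFactor g a) (segment v 0 (e + 1)) -
        conv (polarProd g 0) (lastFactor g a) (segment v 0 e) * (x (e + 1))⁻¹ := fun a => by
    rw [← conv_assoc, hx e (by omega)]
    conv_lhs => rw [hsplit]
    rw [conv_polarInv_append_singleton, ← hsplit, ← hv, segment_zero_length]
  -- The factor at `x₀ = 0` is the source of the coefficient `-(g a)⁻¹` in `stufflePsi`.
  have hinv : ∀ k, invProd x (x (k + 1)) 0 (k + 1) =
      -(x (k + 1))⁻¹ * invProd x (x (k + 1)) 1 (k + 1) := fun k => by
    rw [invProd, Finset.prod_eq_prod_Ico_succ_bot (by omega), hx0, zero_sub, inv_neg]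
    rfl
  rw [polarSum_succ, Finset.sum_range_succ', hx0]
  simp only [stufflePsi, Pi.smul_apply, Pi.add_apply, Finset.sum_apply, smul_eq_mul,
    Pi.sub_apply, mul_sub, Finset.sum_sub_distrib, hD]
  rw [sum_firstFactor hx hv fun y => y ^ (2 * n),
    sum_conv_lastFactor_firstFactor hx hv fun y z => (z - y) ^ (2 * n) * -y⁻¹,
    sum_conv_firstFactor_lastFactor hx hv fun y z => (z - y) ^ (2 * n) * -y⁻¹,
    sum_conv_polarProd_lastFactor hx (fun y => y ^ (2 * n)) hv.ge]
  simp only [← mul_assoc, ← Finset.sum_mul]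
  rw [sum_conv_polarProd_lastFactor hx (fun y => y ^ (2 * n)) (by omega : e ≤ v.length)]
  simp only [hinv, zero_add, sub_zero, zero_sub, inv_neg]
  have h00 : invProd x 0 0 0 = 1 := by simp [invProd]
  rw [h00]
  ring_nf

end StuffleForm

/-! ### Group-like and primitive functions for the shuffle product. -/

section ShuffleForm

variable {α K : Type*} [Field K] (g : α → K)

/-- The sum of the letters of a word. -/
def letterSum (w : List α) : K := (w.map g).sum

@[simp] lemma letterSum_nil : letterSum g ([] : List α) = 0 := rfl

@[simp] lemma letterSum_cons (a : α) (w : List α) :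
    letterSum g (a :: w) = g a + letterSum g w := by simp [letterSum]

@[simp] lemma letterSum_append (u w : List α) :
    letterSum g (u ++ w) = letterSum g u + letterSum g w := by simp [letterSum]

/-- The product of the inverses of the sums of the nonempty prefixes of a word. -/
def prefixProd (w : List α) : K :=
  ∏ i ∈ Finset.range w.length, (letterSum g (w.take (i + 1)))⁻¹

/-- The product of the inverses of minus the sums of the nonempty suffixes of a word. -/
def suffixProd : List α → K
  | [] => 1
  | a :: w => -(letterSum g (a :: w))⁻¹ * suffixProd w

lemma prefixProd_append_singleton (w : List α) (a : α) :
    prefixProd g (w ++ [a]) = prefixProd g w * (letterSum g (w ++ [a]))⁻¹ := by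
  rw [prefixProd, List.length_append, List.length_singleton, Finset.prod_range_succ,
    List.take_of_length_le (by simp), prefixProd]
  congr 1
  refine Finset.prod_congr rfl fun i hi => ?_
  rw [List.take_append_of_le_length (Finset.mem_range.1 hi)]

variable {g}

/-- Every word in a shuffle of `u` and `w` has the same letter sum, so the factor is constant. With
κ = 0 no letters are lost by contraction. -/
lemma quasiShuffle_zero_mul_letterSum (φ : K → K) (F : List α → K) (u w : List α) :
    quasiShuffle 0 u w (fun v => φ (letterSum g v) * F v) =
      φ (letterSum g u + letterSum g w) * quasiShuffle 0 u w F := by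
  induction u generalizing φ F w with
  | nil => simp
  | cons a u ihu =>
    induction w generalizing φ F with
    | nil => simp
    | cons b w ihw =>
      simp only [quasiShuffle_cons_cons, letterSum_cons, Pi.zero_apply, zero_mul, add_zero]
      rw [ihu fun s => φ (g a + s), ihw fun s => φ (g b + s), mul_add]
      simp only [letterSum_cons]
      congr 3 <;> ring

lemma IsPrimitive.mul_letterSum (φ : K → K) {F : List α → K} (hF : IsPrimitive 0 F) :
    IsPrimitive 0 fun v => φ (letterSum g v) * F v := fun u w h => by
  rw [quasiShuffle_zero_mul_letterSum, hF u w h]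
  cases u <;> cases w <;> simp [mul_add]

lemma isPrimitive_letterFn (h : α → K) : IsPrimitive 0 (letterFn h) := fun u w hn => by
  cases u with
  | nil => simp
  | cons a u =>
    cases w with
    | nil => simp
    | cons b w =>
      have hcons : ∀ c : α, (fun v => letterFn h (c :: v)) = h c • counit := fun c => by
        funext v
        rw [letterFn_cons]
        rfl
      have h1 : (u ++ b :: w).Nodup := hn.sublist (List.sublist_cons_self _ _)
      have h2 : (a :: u ++ w).Nodup := hn.sublist ((List.sublist_cons_self b w).append_left _)
      rw [quasiShuffle_cons_cons, hcons, hcons]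
      simp [quasiShuffle_counit h1, quasiShuffle_counit h2]

variable (hS : ∀ w : List α, w ≠ [] → letterSum g w ≠ 0)
include hS

/-- The factor of the full word depends only on its letter sum and comes out of the shuffle. What
remains is (1/s + 1/t)/(s + t) = 1/(st), for the letter sums s, t of the two words. -/
lemma isGroupLike_suffixProd : IsGroupLike 0 (suffixProd g) := fun u w h => by
  clear h
  have hcons : ∀ a : α, (fun v => suffixProd g (a :: v)) =
      fun v => (fun s => -(g a + s)⁻¹) (letterSum g v) * suffixProd g v := fun a => by
    funext v
    simp [suffixProd]
  induction u generalizing w with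
  | nil => simp [suffixProd]
  | cons a u ihu =>
    induction w with
    | nil => simp [suffixProd]
    | cons b w ihw =>
      have h1 := hS (a :: u) (by simp)
      have h2 := hS (b :: w) (by simp)
      have h3 := hS (a :: u ++ b :: w) (by simp)
      rw [quasiShuffle_cons_cons, hcons, hcons,
        quasiShuffle_zero_mul_letterSum fun s => -(g a + s)⁻¹,
        quasiShuffle_zero_mul_letterSum fun s => -(g b + s)⁻¹, ihu, ihw]
      simp only [suffixProd, Pi.zero_apply, zero_mul, add_zero]
      simp only [letterSum_append, letterSum_cons] at *
      have e : g b + (g a + letterSum g u + letterSum g w) =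
        g a + letterSum g u + (g b + letterSum g w) := by ring
      rw [e, ← add_assoc (g a) (letterSum g u)]
      field_simp

lemma conv_prefixProd_suffixProd : conv (prefixProd g) (suffixProd g) = counit := by
  funext w
  rcases List.eq_nil_or_concat w with rfl | ⟨w', a, rfl⟩
  · simp [conv_nil, suffixProd, prefixProd]
  rw [List.concat_eq_append]
  generalize hw : w' ++ [a] = w
  have hne : w ≠ [] := by simp [← hw]
  have hz : counit w = (0 : K) := by rw [← hw, counit_append_singleton]
  rw [hz]
  -- After multiplication by the total sum, written at each cut as prefix sum plus suffix sum, the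
  -- convolution telescopes: the prefix sum cancels the last factor of `prefixProd`, and the suffix
  -- sum cancels the first factor of `suffixProd` up to sign.
  refine (mul_eq_zero.1 ?_).resolve_left (hS w hne)
  rw [conv, Finset.mul_sum]
  have h1 : ∀ i ∈ Finset.range (w.length + 1),
      letterSum g w * (prefixProd g (w.take i) * suffixProd g (w.drop i)) =
        letterSum g (w.take i) * prefixProd g (w.take i) * suffixProd g (w.drop i) +
          prefixProd g (w.take i) * (letterSum g (w.drop i) * suffixProd g (w.drop i)) := by
    intro i _
    conv_lhs => rw [← List.take_append_drop i w]
    rw [letterSum_append]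
    simp only [List.take_append_drop]
    ring
  rw [Finset.sum_congr rfl h1, Finset.sum_add_distrib, Finset.sum_range_succ', add_comm,
    Finset.sum_range_succ]
  simp only [List.take_zero, List.drop_length, letterSum_nil, zero_mul, mul_zero, add_zero]
  rw [← Finset.sum_add_distrib]
  refine Finset.sum_eq_zero fun i hi => ?_
  have hi' := Finset.mem_range.1 hi
  have hd := List.drop_eq_getElem_cons hi'
  have ht := List.take_succ_eq_append_getElem hi'
  have e1 : letterSum g (w.drop i) * suffixProd g (w.drop i) = -suffixProd g (w.drop (i + 1)) := by
    have := hS (w.drop i) (by rw [hd]; exact List.cons_ne_nil _ _)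
    rw [hd] at this ⊢
    rw [suffixProd]
    field_simp
  have e2 : letterSum g (w.take (i + 1)) * prefixProd g (w.take (i + 1)) =
      prefixProd g (w.take i) := by
    have := hS (w.take (i + 1)) (by
      rw [ht]
      exact List.append_ne_nil_of_right_ne_nil _ (List.cons_ne_nil _ _))
    rw [ht] at this ⊢
    rw [prefixProd_append_singleton]
    field_simp
  rw [e1, e2]
  ring

lemma conv_suffixProd_prefixProd : conv (suffixProd g) (prefixProd g) = counit :=
  conv_eq_counit_comm rfl (conv_prefixProd_suffixProd hS)

lemma isGroupLike_prefixProd : IsGroupLike 0 (prefixProd g) :=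
  (isGroupLike_suffixProd hS).of_conv_eq_counit rfl (conv_prefixProd_suffixProd hS)

end ShuffleForm

/-! ### ψ at partial sums, as a combination of primitive functions for the shuffle product. -/

section ShuffleValues

variable {α K : Type*} [Field K] {g : α → K} {v : List α} {x : ℕ → K}

lemma letterSum_segment (hx : ∀ k, x k = letterSum g (v.take k)) {i j : ℕ} (hij : i ≤ j) :
    letterSum g (segment v i j) = x j - x i := by
  have h : v.take j = v.take i ++ segment v i j := by
    conv_lhs => rw [← List.take_append_drop i (v.take j)]
    rw [List.take_take, min_eq_left hij, segment]
  rw [hx, hx, h, letterSum_append, add_sub_cancel_left]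

lemma prefixProd_segment (hx : ∀ k, x k = letterSum g (v.take k)) {i j : ℕ} (hij : i ≤ j)
    (hj : j ≤ v.length) : prefixProd g (segment v i j) = invProd x (x i) (i + 1) (j + 1) := by
  induction j, hij using Nat.le_induction with
  | base => simp [segment_self, invProd, prefixProd]
  | succ j hij ih =>
    rw [segment_succ_right hij (by omega), prefixProd_append_singleton, ih (by omega),
      ← segment_succ_right hij (by omega), letterSum_segment hx (by omega), invProd, invProd,
      Finset.prod_Ico_succ_top (by omega : i + 1 ≤ j + 1)]

lemma suffixProd_segment (hx : ∀ k, x k = letterSum g (v.take k)) {i j : ℕ} (hij : i ≤ j)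
    (hj : j ≤ v.length) : suffixProd g (segment v i j) = invProd x (x j) i j := by
  obtain ⟨m, rfl⟩ := Nat.exists_eq_add_of_le hij
  induction m generalizing i with
  | zero => simp [segment_self, invProd, suffixProd]
  | succ m ih =>
    have h1 := ih (i := i + 1) (by omega) (by omega)
    rw [show i + 1 + m = i + (m + 1) by omega] at h1
    rw [segment_eq_cons (by omega) hj, suffixProd, ← segment_eq_cons (by omega) hj, h1,
      letterSum_segment hx hij, invProd, invProd,
      Finset.prod_eq_prod_Ico_succ_bot (by omega : i < i + (m + 1)), ← inv_neg, neg_sub]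

lemma conv_conv_letterFn_segment (F G : List α → K) {h : α → K} {H : ℕ → K}
    (hH : ∀ k (hk : k < v.length), h v[k] = H k) {i j : ℕ} (hij : i ≤ j) (hj : j ≤ v.length) :
    conv F (conv (letterFn h) G) (segment v i j) =
      ∑ k ∈ Finset.Ico i j, F (segment v i k) * (H k * G (segment v (k + 1) j)) := by
  rw [conv_segment _ _ hij hj, Finset.sum_Ico_succ_top hij, segment_self, conv_nil, letterFn_nil,
    zero_mul, mul_zero, add_zero]
  refine Finset.sum_congr rfl fun k hk => ?_
  have hk' := Finset.mem_Ico.1 hk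
  rw [segment_eq_cons hk'.2 hj, letterFn_conv_cons, hH k (by omega)]

lemma conv_prefixProd_suffixProd_segment (hx : ∀ k, x k = letterSum g (v.take k)) {i j : ℕ}
    (hij : i ≤ j) (hj : j ≤ v.length) :
    conv (prefixProd g) (conv (letterFn 1) (suffixProd g)) (segment v i j) =
      ∑ k ∈ Finset.Ico i j, invProd x (x i) (i + 1) (k + 1) * invProd x (x j) (k + 1) j := by
  rw [conv_conv_letterFn_segment _ _ (H := 1) (fun _ _ => rfl) hij hj]
  refine Finset.sum_congr rfl fun k hk => ?_
  have hk' := Finset.mem_Ico.1 hk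
  rw [prefixProd_segment hx hk'.1 (by omega), suffixProd_segment hx hk'.2 hj, Pi.one_apply, one_mul]

variable (g) in
/-- The value of `ψ_{2n+1}` at the partial sums of a word, in terms of primitive elements for the
shuffle product. -/
noncomputable def shufflePsi (n : ℕ) : List α → K :=
  let A : List α → K := fun v =>
    letterSum g v ^ (2 * n) * conv (prefixProd g) (conv (letterFn 1) (suffixProd g)) v
  (1 / 2 : K) • (conv (suffixProd g) (conv (letterFn fun a => g a ^ (2 * n)) (prefixProd g)) + A) +
    (-(1 / 2) : K) • fun v =>
      (letterSum g v)⁻¹ * (conv A (letterFn 1) - conv (letterFn 1) A) v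

lemma isPrimitive_shufflePsi (hS : ∀ w : List α, w ≠ [] → letterSum g w ≠ 0) (n : ℕ) :
    IsPrimitive 0 (shufflePsi g n) := by
  have hA := ((isPrimitive_letterFn (1 : α → K)).conj (isGroupLike_prefixProd hS)
    (isGroupLike_suffixProd hS) (conv_prefixProd_suffixProd hS)).mul_letterSum (g := g)
      fun s => s ^ (2 * n)
  refine .add (.smul _ (.add ?_ hA)) (.smul _ (.mul_letterSum (g := g) (fun s => s⁻¹)
    (hA.commutator (isPrimitive_letterFn 1))))
  exact (isPrimitive_letterFn _).conj (isGroupLike_suffixProd hS) (isGroupLike_prefixProd hS)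
    (conv_suffixProd_prefixProd hS)

lemma shufflePsi_eq_polarSum (n : ℕ) (hx : ∀ k, x k = letterSum g (v.take k)) :
    shufflePsi g n v = polarSum n v.length x := by
  rcases hv : v.length with _ | e
  · rw [List.length_eq_zero_iff] at hv
    subst hv
    simp [shufflePsi, polarSum, conv_nil]
  have hx0 : x 0 = 0 := by simp [hx]
  have hseg : v = segment v 0 (e + 1) := by rw [← hv, segment_zero_length]
  have hlast : v = segment v 0 e ++ [v[e]] := by
    rw [← segment_succ_right (Nat.zero_le e) (by omega), ← hseg]
  have hfirst : v = v[0] :: segment v 1 (e + 1) := by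
    rw [← segment_eq_cons (by omega) (by omega), ← hseg]
  have hg : ∀ k (hk : k < v.length), g v[k] ^ (2 * n) = (x (k + 1) - x k) ^ (2 * n) := by
    intro k hk
    have := letterSum_segment hx (Nat.le_succ k)
    rw [segment_succ_right le_rfl hk, segment_self] at this
    rw [← this]
    simp
  have hsum : letterSum g v = x (e + 1) - x 0 := by
    rw [← letterSum_segment hx (Nat.zero_le _), ← hseg]
  have h1 : conv (suffixProd g) (conv (letterFn fun a => g a ^ (2 * n)) (prefixProd g)) v =
      ∑ k ∈ Finset.range (e + 1), (x (k + 1) - x k) ^ (2 * n) *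
        (invProd x (x k) 0 k * invProd x (x (k + 1)) (k + 2) (e + 2)) := by
    conv_lhs => rw [hseg]
    rw [conv_conv_letterFn_segment _ _ hg (Nat.zero_le _) hv.ge, Finset.range_eq_Ico]
    refine Finset.sum_congr rfl fun k hk => ?_
    have hk' := Finset.mem_Ico.1 hk
    rw [suffixProd_segment hx (Nat.zero_le _) (by omega), prefixProd_segment hx hk'.2 hv.ge]
    ring
  have h2 : conv (prefixProd g) (conv (letterFn 1) (suffixProd g)) v =
      ∑ k ∈ Finset.range (e + 1),
        invProd x (x 0) 1 (k + 1) * invProd x (x (e + 1)) (k + 1) (e + 1) := by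
    conv_lhs => rw [hseg]
    rw [conv_prefixProd_suffixProd_segment hx (Nat.zero_le _) hv.ge, Finset.range_eq_Ico]
  rw [polarSum_succ]
  simp only [shufflePsi, Pi.smul_apply, Pi.add_apply, Pi.sub_apply, smul_eq_mul, h1, h2, hsum]
  -- The two halves of the commutator delete the last and the first letter, giving the `x_{d-1}` and
  -- the `x_1 - x_d` fractions.
  have h3 : ∀ A : List α → K, conv A (letterFn 1) v = A (segment v 0 e) := fun A => by
    conv_lhs => rw [hlast]
    rw [conv_letterFn_append_singleton, Pi.one_apply, mul_one]
  have h4 : ∀ A : List α → K, conv (letterFn 1) A v = A (segment v 1 (e + 1)) := fun A => by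
    conv_lhs => rw [hfirst]
    rw [letterFn_conv_cons, Pi.one_apply, one_mul]
  -- Deleting the first letter gives the power of `x_d - x_1`; the even exponent identifies it with
  -- that of `x_1 - x_d`.
  rw [h3, h4, conv_prefixProd_suffixProd_segment hx (Nat.zero_le _) (by omega),
    conv_prefixProd_suffixProd_segment hx (by omega) hv.ge, letterSum_segment hx (Nat.zero_le _),
    letterSum_segment hx (by omega), Finset.sum_Ico_eq_sum_range _ 1, ← Finset.range_eq_Ico,
    ← neg_sub (x (e + 1)) (x 1), (even_two_mul n).neg_pow, ← neg_sub (x (e + 1)) (x 0), inv_neg,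
    hx0]
  simp only [Nat.add_sub_cancel, show ∀ k, 1 + k + 1 = k + 2 by omega, sub_zero]
  ring

end ShuffleValues

/-! ### Transfer to the words of variables, and the double shuffle equations. -/

section MainTheorem

variable {α K : Type*} [Field K] (g : α → K)

lemma sum_map_shuffles (F : List K → K) (u w : List α) :
    ((shuffles (u.map g) (w.map g)).map F).sum =
      quasiShuffle 0 u w fun v => F (v.map g) := by
  induction u generalizing F w with
  | nil => simp [shuffles]
  | cons a u ihu =>
    induction w generalizing F with
    | nil => simp [shuffles]
    | cons b w ihw =>
      have h1 := ihu (fun v => F (g a :: v)) (b :: w)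
      have h2 := ihw fun v => F (g b :: v)
      simp only [List.map_cons] at h1 h2
      simp only [List.map_cons, shuffles, List.map_append, List.map_map, List.sum_append,
        quasiShuffle_cons_cons, Pi.zero_apply, zero_mul, add_zero]
      rw [← h1, ← h2]
      rfl

lemma stuffle_map (F : List K → K) (u w : List α) :
    stuffle F (u.map g) (w.map g) =
      quasiShuffle (stuffleCoeff g) u w fun v => F (v.map g) := by
  induction u generalizing F w with
  | nil => simp [stuffle]
  | cons a u ihu =>
    induction w generalizing F with
    | nil => simp [stuffle]
    | cons b w ihw =>
      have h1 := ihu (fun v => F (g a :: v)) (b :: w)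
      have h2 := ihw fun v => F (g b :: v)
      simp only [List.map_cons] at h1 h2
      simp only [List.map_cons, stuffle, quasiShuffle_cons_cons, h1, h2, ihu, stuffleCoeff]
      ring

lemma length_partialSumsFrom (s : K) (v : List K) : (partialSumsFrom s v).length = v.length := by
  induction v generalizing s with
  | nil => rfl
  | cons a v ih => simp [partialSumsFrom, ih]

lemma getElem_partialSumsFrom (s : K) (v : List α) (k : ℕ)
    (hk : k < (partialSumsFrom s (v.map g)).length) :
    (partialSumsFrom s (v.map g))[k] = s + letterSum g (v.take (k + 1)) := by
  induction v generalizing s k with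
  | nil => simp [partialSumsFrom] at hk
  | cons a v ih =>
    cases k with
    | zero => simp [partialSumsFrom]
    | succ k =>
      simp only [List.map_cons, partialSumsFrom, List.getElem_cons_succ, ih]
      rw [List.take_succ_cons, letterSum_cons, add_assoc]

variable {g}

lemma sharp_psi_map [Algebra ℚ K] [CharZero K] (hS : ∀ w : List α, w ≠ [] → letterSum g w ≠ 0)
    (n : ℕ) (v : List α) : sharp (psi n) (v.map g) = shufflePsi g n v := by
  have hl : (partialSumsFrom 0 (v.map g)).length = v.length := by
    rw [length_partialSumsFrom, List.length_map]
  rw [shufflePsi_eq_polarSum n fun k => rfl, sharp,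
    evalWord_psi (x := fun k => letterSum g (v.take k)), hl]
  · simp
  · intro k hk
    rw [getElem_partialSumsFrom, zero_add]
  · have key : ∀ k l, k < l → l ≤ v.length →
        letterSum g (v.take k) ≠ letterSum g (v.take l) := fun k l hkl hl h => by
      refine hS (segment v k l) ?_ ?_
      · rw [segment_eq_cons hkl hl]
        exact List.cons_ne_nil _ _
      · rw [letterSum_segment (fun _ => rfl) hkl.le, h, sub_self]
    rw [hl]
    intro k hk l hl' hkl
    rcases lt_or_gt_of_ne hkl with h | h
    · exact key k l h hl'
    · exact (key l k h hk).symm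

lemma evalWord_psi_map [Algebra ℚ K] [CharZero K] [DecidableEq α] [Fintype α]
    (hg : Function.Injective g) (hg0 : ∀ a, g a ≠ 0) (n : ℕ) {v : List α} (hv : v.Nodup) :
    evalWord (psi n) (v.map g) = stufflePsi g n v := by
  -- The head `0` of the list supplies `x₀ = 0`; the default value is never read at indices up to
  -- the length of the word.
  have hx : ∀ k (h : k < v.length), (0 :: v.map g).getD (k + 1) 0 = g v[k] := fun k h => by
    simp [h]
  rw [stufflePsi_eq_polarSum n (x := fun k => (0 :: v.map g).getD k 0) rfl hx,
    evalWord_psi (x := fun k => (0 :: v.map g).getD k 0) n _ rfl, List.length_map]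
  · intro k hk
    rw [hx k (by simpa using hk), List.getElem_map]
  · have hnd : (0 :: v.map g).Nodup :=
      List.nodup_cons.2 ⟨by simpa using fun a _ => hg0 a, hv.map hg⟩
    rw [List.length_map]
    intro k hk l hl hkl
    have hk' : k < (0 :: v.map g).length := by simp; omega
    have hl' : l < (0 :: v.map g).length := by simp; omega
    simp only [List.getD_eq_getElem _ _ hk', List.getD_eq_getElem _ _ hl']
    exact fun h => hkl ((hnd.getElem_inj_iff).1 h)

lemma var_injective (d : ℕ) : Function.Injective (var : Fin d → RatFun d) :=
  (IsFractionRing.injective (MvPolynomial (Fin d) ℚ) (RatFun d)).comp MvPolynomial.X_injective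

lemma var_ne_zero {d : ℕ} (i : Fin d) : (var i : RatFun d) ≠ 0 := fun h =>
  MvPolynomial.X_ne_zero i
    ((FaithfulSMul.algebraMap_eq_zero_iff (MvPolynomial (Fin d) ℚ) (RatFun d)).1 h)

lemma letterSum_var_ne_zero {d : ℕ} (w : List (Fin d)) (hw : w ≠ []) :
    letterSum (var : Fin d → RatFun d) w ≠ 0 := fun h => by
  have h1 : letterSum (var : Fin d → RatFun d) w =
      algebraMap (MvPolynomial (Fin d) ℚ) _ (w.map (MvPolynomial.X (R := ℚ))).sum := by
    rw [map_list_sum, List.map_map]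
    rfl
  rw [h1, FaithfulSMul.algebraMap_eq_zero_iff] at h
  -- Setting all variables equal to 1 turns the sum into the length of the word, which is nonzero.
  have h2 := congrArg (MvPolynomial.aeval fun _ => (1 : ℚ)) h
  rw [map_list_sum, List.map_map, map_zero] at h2
  have h3 : (MvPolynomial.aeval (fun _ => (1 : ℚ)) ∘ MvPolynomial.X (R := ℚ) : Fin d → ℚ) =
      fun _ => 1 := by
    funext i
    simp
  rw [h3] at h2
  simp [hw] at h2

variable (p q : ℕ)

lemma leftWord_eq : leftWord p q = (List.ofFn (Fin.castAdd q : Fin p → _)).map var := by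
  rw [List.map_ofFn]
  rfl

lemma rightWord_eq : rightWord p q = (List.ofFn (Fin.natAdd p : Fin q → _)).map var := by
  rw [List.map_ofFn]
  rfl

lemma nodup_ofFn_castAdd_append_ofFn_natAdd :
    (List.ofFn (Fin.castAdd q : Fin p → _) ++ List.ofFn (Fin.natAdd p : Fin q → _)).Nodup := by
  refine List.nodup_append.2 ⟨List.nodup_ofFn.2 (Fin.castAdd_injective p q),
    List.nodup_ofFn.2 (Fin.natAdd_injective q p), ?_⟩
  simp only [List.mem_ofFn]
  rintro _ ⟨i, rfl⟩ _ ⟨j, rfl⟩ h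
  have := congrArg Fin.val h
  simp at this
  omega

lemma shuffleModProducts_psi (n : ℕ) : ShuffleModProducts (psi n) := fun p q hp hq => by
  rw [shuffleValue, leftWord_eq, rightWord_eq, sum_map_shuffles,
    funext (sharp_psi_map letterSum_var_ne_zero n)]
  exact (isPrimitive_shufflePsi letterSum_var_ne_zero n).eq_zero
    (nodup_ofFn_castAdd_append_ofFn_natAdd p q) (by simp; omega) (by simp; omega)

lemma stuffleModProducts_psi (n : ℕ) : StuffleModProducts (psi n) := fun p q hp hq => by
  have hnd := nodup_ofFn_castAdd_append_ofFn_natAdd p q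
  rw [leftWord_eq, rightWord_eq, stuffle_map, quasiShuffle_congr _ fun v hv =>
    evalWord_psi_map (var_injective _) var_ne_zero n
      (hv.elim fun _ h => h.1.nodup_iff.1 (hnd.sublist h.2))]
  exact (isPrimitive_stufflePsi (var_injective _) var_ne_zero n).eq_zero hnd
    (by simp; omega) (by simp; omega)

lemma psi_zero (n : ℕ) : psi n 0 = 0 := by simp [psi]

end MainTheorem

end PolarDoubleShuffle

theorem mainTheorem1 (n : ℕ) (hn : 1 ≤ n) :
    PolarDoubleShuffle.psi n ∈ PolarDoubleShuffle.pdmr :=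
  ⟨⟨PolarDoubleShuffle.psi_zero n, fun d _ => PolarDoubleShuffle.psi_mem_polarRing n d⟩,
    PolarDoubleShuffle.shuffleModProducts_psi n, PolarDoubleShuffle.stuffleModProducts_psi n⟩
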